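/- Let $n\ge 1$ and let $\mathbb{H}^{2n+1}=\{(x_1,\dots,x_{2n},z)\in\mathbb{R}^{2n+1} : z>0\}$ carry the hyperbolic metric $g=z^{-2}\,\overline g$, where $\overline g=\sum_i dx_i^2+dz^2$ is the Euclidean metric. Let $M$ be a smooth compact hypersurface, with or without boundary, embedded in $\mathbb{H}^{2n+1}$. If $\kappa_1,\dots,\kappa_{2n}$ are the principal curvatures of $M$ in $(\mathbb{H}^{2n+1},g)$ with respect to a choice of unit normal, put $$H=\frac1{2n}\sum_i\kappa_i,\qquad R=\frac{1}{2n(2n-1)}\sum_{i\ne j}\kappa_i\kappa_j,\qquad \lambda=\frac1{2n(2n-1)}\sum_{i\neq j}K(e_i,e_j),$$ where $K$ denotes the (intrinsic) sectional curvature of the metric induced on $M$ by $g$ and $(e_i)$ is any orthonormal frame tangent to $M$. Let $dA$ be the volume element on $M$ induced by $g$ and $\mathcal{A}(M)=\int_M 1\,dA$ the area. Let $\overline H,\overline R,\overline\lambda, d\overline A$ denote the same objects for $M$ regarded as a hypersurface of $(\mathbb{R}^{2n+1},\overline g)$. Then all the integrals below converge and $$\mathcal{A}(M)=\sum_{i=0}^{n-1}(-1)^{n+i}\binom{n}{i}\left(\int_M\overline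 H^{2(n-i)}\overline R^{i}\,d\overline A-\int_M H^{2(n-i)}R^{i}\,dA\right)+\int_M\overline\lambda^{\,n}\,d\overline A-\sum_{i=1}^{n}\binom{n}{i}\int_M\lambda^{i}\,dA .$$ -/

import Mathlib

open scoped Manifold ContDiff
open MeasureTheory

namespace HypersurfaceArea

noncomputable section

/-! ### Riemannian metrics in coordinates -/

/-- A (Riemannian) metric written in the standard coordinates of `ℝ^m`: the matrix `(g_ij)` of its
components at every point. -/
abbrev MetricField (m : ℕ) : Type :=
  EuclideanSpace ℝ (Fin m) → Matrix (Fin m) (Fin m) ℝ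

/-- The value `g_p(v, w)`. -/
def MetricField.pair {m : ℕ} (g : MetricField m) (p v w : EuclideanSpace ℝ (Fin m)) : ℝ :=
  ∑ a, ∑ b, g p a b * v a * w b

/-- The Euclidean metric. -/
def euclideanMetric (m : ℕ) : MetricField m := fun _ => 1

/-- The open upper half-space `{z > 0}` of `ℝ^(m+1)`, where `z` is the last coordinate. -/
def upperHalfSpace (m : ℕ) : Set (EuclideanSpace ℝ (Fin (m + 1))) :=
  {p | 0 < p (Fin.last m)}

/-- The hyperbolic metric `(1 / z^2) (dx_1^2 + ... + dx_m^2 + dz^2)` of the upper half-space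
(only its values at points with `z > 0` matter). -/
def hyperbolicMetric (m : ℕ) : MetricField (m + 1) :=
  fun p => (1 / p (Fin.last m) ^ 2) • (1 : Matrix (Fin (m + 1)) (Fin (m + 1)) ℝ)

/-- The `i`-th partial derivative, relative to a set `S` (which is the whole space, or a half-space
when a boundary chart is used). -/
def partialD {m : ℕ} {V : Type*} [NormedAddCommGroup V] [NormedSpace ℝ V]
    (S : Set (EuclideanSpace ℝ (Fin m))) (i : Fin m) (F : EuclideanSpace ℝ (Fin m) → V)
    (u : EuclideanSpace ℝ (Fin m)) : V :=
  fderivWithin ℝ F S u (EuclideanSpace.single i 1)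

/-- The Christoffel symbol `Γ^k_{ij}` of the Levi-Civita connection of `g`. -/
def christoffel {m : ℕ} (S : Set (EuclideanSpace ℝ (Fin m))) (g : MetricField m)
    (k i j : Fin m) (u : EuclideanSpace ℝ (Fin m)) : ℝ :=
  1 / 2 * ∑ l, (g u)⁻¹ k l *
    (partialD S i (fun v => g v j l) u + partialD S j (fun v => g v i l) u
      - partialD S l (fun v => g v i j) u)

/-- The component `Rm(∂_i, ∂_j, ∂_k, ∂_l) = g(R(∂_i, ∂_j) ∂_l, ∂_k)` of the Riemann curvature of
`g`; the sign is such that `Rm(e_1, e_2, e_1, e_2)` is the sectional curvature of the plane spanned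
by the orthonormal vectors `e_1, e_2`. -/
def riemann {m : ℕ} (S : Set (EuclideanSpace ℝ (Fin m))) (g : MetricField m)
    (i j k l : Fin m) (u : EuclideanSpace ℝ (Fin m)) : ℝ :=
  ∑ a, g u k a *
    (partialD S i (christoffel S g a j l) u - partialD S j (christoffel S g a i l) u
      + ∑ b, (christoffel S g a i b u * christoffel S g b j l u
        - christoffel S g a j b u * christoffel S g b i l u))

/-- The normalized scalar curvature: `1 / (m (m - 1))` times the full trace of the Riemann
curvature. -/
def scalarCurvatureAt {m : ℕ} (S : Set (EuclideanSpace ℝ (Fin m))) (g : MetricField m)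
    (u : EuclideanSpace ℝ (Fin m)) : ℝ :=
  1 / ((m : ℝ) * ((m : ℝ) - 1)) *
    ∑ i, ∑ j, ∑ k, ∑ l, (g u)⁻¹ i k * (g u)⁻¹ j l * riemann S g i j k l u

theorem riemann_swap {m : ℕ} (S : Set (EuclideanSpace ℝ (Fin m))) (g : MetricField m)
    (i j k l : Fin m) (u : EuclideanSpace ℝ (Fin m)) :
    riemann S g j i k l u = - riemann S g i j k l u := by
  unfold riemann
  rw [← Finset.sum_neg_distrib]
  refine Finset.sum_congr rfl fun a _ => ?_
  rw [Finset.sum_sub_distrib, Finset.sum_sub_distrib]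
  ring

/-- The scalar curvature is `1 / (m (m - 1)) ∑_{a ≠ b} Rm(e_a, e_b, e_a, e_b)` for every
orthonormal frame `e_a = ∑ i, P i a ∂_i`. -/
theorem scalarCurvatureAt_eq_frame {m : ℕ} (S : Set (EuclideanSpace ℝ (Fin m)))
    (g : MetricField m) (u : EuclideanSpace ℝ (Fin m)) (P : Matrix (Fin m) (Fin m) ℝ)
    (hP : P.transpose * g u * P = 1) :
    scalarCurvatureAt S g u = 1 / ((m : ℝ) * ((m : ℝ) - 1)) *
      ∑ a, ∑ b, if a ≠ b then
        ∑ i, ∑ j, ∑ k, ∑ l, P i a * P j b * P k a * P l b * riemann S g i j k l u else 0 := by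
  have h1 : P * P.transpose * g u = 1 := by
    rw [Matrix.mul_assoc]
    exact mul_eq_one_comm.mp hP
  have h2 : (g u)⁻¹ = P * P.transpose := Matrix.inv_eq_left_inv h1
  have h3 : ∀ i k, (g u)⁻¹ i k = ∑ a, P i a * P k a := by
    intro i k
    rw [h2, Matrix.mul_apply]
    rfl
  unfold scalarCurvatureAt
  congr 1
  have h4 : ∀ a b : Fin m, (if a ≠ b then
      ∑ i, ∑ j, ∑ k, ∑ l, P i a * P j b * P k a * P l b * riemann S g i j k l u else 0)
      = ∑ i, ∑ j, ∑ k, ∑ l, P i a * P j b * P k a * P l b * riemann S g i j k l u := by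
    intro a b
    by_cases hab : a = b
    · subst hab
      rw [if_neg (by simp)]
      have h5 : ∑ i, ∑ j, ∑ k, ∑ l, P i a * P j a * P k a * P l a * riemann S g i j k l u
          = - ∑ i, ∑ j, ∑ k, ∑ l, P i a * P j a * P k a * P l a * riemann S g i j k l u := by
        conv_lhs => rw [Finset.sum_comm]
        simp only [← Finset.sum_neg_distrib]
        refine Finset.sum_congr rfl fun i _ => Finset.sum_congr rfl fun j _ =>
          Finset.sum_congr rfl fun k _ => Finset.sum_congr rfl fun l _ => ?_
        rw [riemann_swap]
        ring
      linarith
    · rw [if_pos hab]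
  simp only [h4, h3]
  have h6 : ∀ T : Fin m → Fin m → Fin m → Fin m → Fin m → Fin m → ℝ,
      ∑ a, ∑ b, ∑ i, ∑ j, ∑ k, ∑ l, T a b i j k l
        = ∑ i, ∑ j, ∑ k, ∑ l, ∑ a, ∑ b, T a b i j k l := by
    intro T
    have : ∀ U : Fin m → Fin m → Fin m → ℝ, ∑ a, ∑ b, ∑ i, U a b i = ∑ i, ∑ a, ∑ b, U a b i := by
      intro U
      rw [Finset.sum_comm (s := Finset.univ) (t := Finset.univ)
        (f := fun i a => ∑ b, U a b i)]
      exact Finset.sum_congr rfl fun a _ => Finset.sum_comm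
    rw [this]
    refine Finset.sum_congr rfl fun i _ => ?_
    rw [this]
    refine Finset.sum_congr rfl fun j _ => ?_
    rw [this]
    refine Finset.sum_congr rfl fun k _ => ?_
    rw [this]
  rw [h6]
  refine Finset.sum_congr rfl fun i _ => Finset.sum_congr rfl fun j _ =>
    Finset.sum_congr rfl fun k _ => Finset.sum_congr rfl fun l _ => ?_
  rw [Finset.sum_mul_sum, Finset.sum_mul]
  refine Finset.sum_congr rfl fun a _ => ?_
  rw [Finset.sum_mul]
  refine Finset.sum_congr rfl fun b _ => ?_
  ring

/-! ### Hypersurfaces in local parametrizations -/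

section Local

variable {m N : ℕ}

/-- The metric `F^* G` induced by a parametrization `F` defined on `S ⊆ ℝ^m` from the ambient
metric `G` of (an open subset of) `ℝ^N`. -/
def inducedMetric (G : MetricField N) (S : Set (EuclideanSpace ℝ (Fin m)))
    (F : EuclideanSpace ℝ (Fin m) → EuclideanSpace ℝ (Fin N)) : MetricField m :=
  fun u => Matrix.of fun i j => G.pair (F u) (partialD S i F u) (partialD S j F u)

/-- The ambient covariant derivative `∇_{∂_i F} ∂_j F`, for the Levi-Civita connection of `G`. -/
def covariantHessian (G : MetricField N) (S : Set (EuclideanSpace ℝ (Fin m)))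
    (F : EuclideanSpace ℝ (Fin m) → EuclideanSpace ℝ (Fin N)) (i j : Fin m)
    (u : EuclideanSpace ℝ (Fin m)) : EuclideanSpace ℝ (Fin N) :=
  WithLp.toLp 2 fun a => partialD S i (partialD S j F) u a
    + ∑ b, ∑ c, christoffel Set.univ G a b c (F u) * partialD S i F u b * partialD S j F u c

/-- The second fundamental form `B_ij = G(∇_{∂_i F} ∂_j F, ν)` with respect to the unit normal
vector `ν` at `F u`. -/
def secondForm (G : MetricField N) (S : Set (EuclideanSpace ℝ (Fin m)))
    (F : EuclideanSpace ℝ (Fin m) → EuclideanSpace ℝ (Fin N)) (ν : EuclideanSpace ℝ (Fin N))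
    (u : EuclideanSpace ℝ (Fin m)) : Matrix (Fin m) (Fin m) ℝ :=
  Matrix.of fun i j => G.pair (F u) (covariantHessian G S F i j u) ν

/-- The principal curvatures, with multiplicity: the eigenvalues of the shape operator, i.e. of the
second fundamental form with respect to the induced metric. -/
def principalCurvaturesAt (G : MetricField N) (S : Set (EuclideanSpace ℝ (Fin m)))
    (F : EuclideanSpace ℝ (Fin m) → EuclideanSpace ℝ (Fin N)) (ν : EuclideanSpace ℝ (Fin N))
    (u : EuclideanSpace ℝ (Fin m)) : Multiset ℝ :=
  ((inducedMetric G S F u)⁻¹ * secondForm G S F ν u).charpoly.roots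

end Local

/-! ### Hypersurfaces -/

section Global

variable {m : ℕ} {X : Type*} [TopologicalSpace X]
  (I : ModelWithCorners ℝ (EuclideanSpace ℝ (Fin m)) X)
  {M : Type*} [TopologicalSpace M] [ChartedSpace X M]

/-- `f` is a smooth embedding of the `m`-dimensional manifold `M` (possibly with boundary) as a
hypersurface of `ℝ^(m+1)`. -/
structure IsEmbeddedHypersurface (f : M → EuclideanSpace ℝ (Fin (m + 1))) : Prop where
  smooth : ContMDiff I 𝓘(ℝ, EuclideanSpace ℝ (Fin (m + 1))) ∞ f
  immersive : ∀ x, Function.Injective (mfderiv I 𝓘(ℝ, EuclideanSpace ℝ (Fin (m + 1))) f x)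
  isEmbedding : Topology.IsEmbedding f

variable (G : MetricField (m + 1)) (f : M → EuclideanSpace ℝ (Fin (m + 1)))
  (ν : M → EuclideanSpace ℝ (Fin (m + 1)))

/-- `ν` is a choice of a `G`-unit normal vector at every point of the hypersurface. -/
def IsUnitNormal : Prop :=
  ∀ x, G.pair (f x) (ν x) (ν x) = 1 ∧
    ∀ v : TangentSpace I x,
      G.pair (f x) (mfderiv I 𝓘(ℝ, EuclideanSpace ℝ (Fin (m + 1))) f x v) (ν x) = 0

/-- The parametrization of the hypersurface by the chart at `x`. -/
def chartParam (x : M) : EuclideanSpace ℝ (Fin m) → EuclideanSpace ℝ (Fin (m + 1)) :=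
  fun u => f ((extChartAt I x).symm u)

/-- The principal curvatures of the hypersurface at `x`. -/
def principalCurvatures (x : M) : Multiset ℝ :=
  principalCurvaturesAt G (Set.range I) (chartParam I f x) (ν x) (extChartAt I x x)

/-- The mean curvature `(1 / m) ∑_i κ_i`. -/
def meanCurvature (x : M) : ℝ :=
  1 / (m : ℝ) * (principalCurvatures I G f ν x).sum

/-- The extrinsic scalar curvature `1 / (m (m - 1)) ∑_{i ≠ j} κ_i κ_j`; the sum over ordered pairs
is twice the second elementary symmetric function. -/
def extrinsicScalarCurvature (x : M) : ℝ :=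
  1 / ((m : ℝ) * ((m : ℝ) - 1)) * (2 * (principalCurvatures I G f ν x).esymm 2)

/-- The intrinsic (normalized) scalar curvature of the induced metric. -/
def scalarCurvature (x : M) : ℝ :=
  scalarCurvatureAt (Set.range I) (inducedMetric G (Set.range I) (chartParam I f x))
    (extChartAt I x x)

/-- Finitely many compact sets, each inside a chart domain, that cover the manifold. -/
structure ChartCover (X : Type*) [TopologicalSpace X] (M : Type*) [TopologicalSpace M]
    [ChartedSpace X M] where
  card : ℕ
  center : Fin card → M
  piece : Fin card → Set M
  isCompact_piece : ∀ k, IsCompact (piece k)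
  piece_subset : ∀ k, piece k ⊆ (chartAt X (center k)).source
  cover : ∀ x, ∃ k, x ∈ piece k

/-- A compact manifold has such a cover. -/
theorem nonempty_chartCover {m : ℕ} {X : Type*} [TopologicalSpace X]
    (I : ModelWithCorners ℝ (EuclideanSpace ℝ (Fin m)) X)
    (M : Type*) [TopologicalSpace M] [ChartedSpace X M] [CompactSpace M] :
    Nonempty (ChartCover X M) := by
  have : LocallyCompactSpace X := I.locallyCompactSpace
  have : LocallyCompactSpace M := ChartedSpace.locallyCompactSpace X M
  have h : ∀ x : M, ∃ K ∈ nhds x, K ⊆ (chartAt X x).source ∧ IsCompact K := fun x =>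
    local_compact_nhds ((chartAt X x).open_source.mem_nhds (mem_chart_source X x))
  choose K hK hsub hcomp using h
  obtain ⟨t, ht⟩ := (isCompact_univ (X := M)).elim_nhds_subcover K fun x _ => hK x
  refine ⟨⟨t.card, fun k => (t.equivFin.symm k : M), fun k => K (t.equivFin.symm k),
    fun k => hcomp _, fun k => hsub _, fun x => ?_⟩⟩
  obtain ⟨y, hy, hxy⟩ := Set.mem_iUnion₂.mp (ht.2 (Set.mem_univ x))
  exact ⟨t.equivFin ⟨y, hy⟩, by simpa using hxy⟩

variable [MeasurableSpace M]

/-- The volume element of the induced metric in the chart at `x`, namely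
`√(det g_ij) du_1 ... du_m`, as a measure on the manifold (carried by the chart domain). -/
def chartVolume (x : M) : Measure M :=
  Measure.map (extChartAt I x).symm
    ((volume.restrict (extChartAt I x).target).withDensity fun u =>
      ENNReal.ofReal
        (Real.sqrt (inducedMetric G (Set.range I) (chartParam I f x) u).det))

/-- The volume element of the induced metric: the hypersurface is cut into finitely many disjoint
pieces lying in chart domains, and on every piece the volume is computed in the chart (by the change
of variables formula the result does not depend on the pieces and the charts). -/
def volumeElement [CompactSpace M] : Measure M :=
  let C : ChartCover X M := Classical.choice (nonempty_chartCover I M)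
  ∑ k, (chartVolume I G f (C.center k)).restrict
    (C.piece k \ ⋃ j : Fin C.card, ⋃ _ : j < k, C.piece j)

/-- The area `∫_M 1 dA`. -/
def area [CompactSpace M] : ℝ := ∫ _, (1 : ℝ) ∂(volumeElement I G f)

end Global

end

end HypersurfaceArea

open HypersurfaceArea

namespace HypersurfaceArea

open scoped Topology

noncomputable section

/-! ### Linear algebra -/

/-! The formula is the integrated form of a conformal invariance. Write m = 2n, let A be the
Euclidean shape operator and ν the Euclidean unit normal. A hyperbolic unit normal is aν with a =
±z, and the hyperbolic shape operator is a(A + (ν_z/z)·1): apart from the factor a, only a multiple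
of the identity is added. Since H² − R equals tr(A₀²)/(m(m − 1)), where A₀ is the traceless part of
A, it is multiplied by z² (`sq_meanCurvature_sub_hyperbolicMetric`). The volume element is
multiplied by z^(-m) (`volumeElement_hyperbolicMetric`). As m = 2n, the measure (H² − R)^n dA is the
same for both metrics. Binomial expansion expresses the integral of R^n dA through the Euclidean
integrals and the mixed integrals of H and R.

The area enters through the Gauss equation: λ = R − 1 in the hyperbolic case and λ = R in the
Euclidean one. Hence R^n = (λ + 1)^n, and the constant term of its expansion integrates to the area.
Both Gauss equations come from one computation, `riemann_flatMetric`, for a metric induced from a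
vector space with a constant symmetric bilinear form. The hyperbolic case uses the isometric lift of
the upper half-space to the hyperboloid in Minkowski space.

Convergence needs an argument because the unit normals are arbitrary functions, whose sign may jump
from point to point, so that H need not be continuous. The integrands involve only H² and R, which
do not change when the normal changes sign. In a fixed chart they are rewritten without the normal
(`normalProduct_eq`, `eventually_chartShape`), which gives their continuity; a continuous function
on compact M is integrable for the two finite volume measures. -/

/-- Newton's identity. It turns the sum over pairs of principal curvatures into the traces of the
shape operator and of its square. -/
theorem two_mul_esymm_two (s : Multiset ℝ) :
    2 * s.esymm 2 = s.sum ^ 2 - (s.map (· ^ 2)).sum := by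
  induction s using Multiset.induction_on with
  | empty => simp [Multiset.esymm, Multiset.powersetCard_zero_right 1]
  | cons a s ih =>
    have h : (a ::ₘ s).esymm 2 = s.esymm 2 + a * s.sum := by
      simp [Multiset.esymm, Multiset.powersetCard_cons, Multiset.powersetCard_one,
        Multiset.map_map]
      rw [Multiset.sum_map_mul_left, Multiset.map_id']
    rw [h, mul_add, ih, Multiset.sum_cons, Multiset.map_cons, Multiset.sum_cons]
    ring

theorem trace_mul_self_eq_sum_sq_roots_charpoly {m : ℕ} {A : Matrix (Fin m) (Fin m) ℝ}
    (hA : A.IsHermitian) : (A * A).trace = (A.charpoly.roots.map (· ^ 2)).sum := by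
  have h : A * A = Unitary.conjStarAlgAut ℝ _ hA.eigenvectorUnitary
      (Matrix.diagonal (RCLike.ofReal ∘ hA.eigenvalues) *
        Matrix.diagonal (RCLike.ofReal ∘ hA.eigenvalues)) := by
    rw [map_mul, ← hA.spectral_theorem]
  rw [hA.roots_charpoly_eq_eigenvalues, h, Unitary.conjStarAlgAut_apply, Matrix.trace_mul_cycle,
    Unitary.coe_star_mul_self, one_mul, Matrix.diagonal_mul_diagonal,
    Matrix.trace_diagonal, Multiset.map_map]
  simp [sq, Finset.sum]

open MatrixOrder in
/-- The eigenvalues of `h⁻¹ B` are those of a symmetric matrix. -/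
theorem exists_isHermitian_charpoly_eq {m : ℕ} {h B : Matrix (Fin m) (Fin m) ℝ}
    (hh : h.PosSemidef) (hB : B.transpose = B) :
    ∃ C : Matrix (Fin m) (Fin m) ℝ, C.IsHermitian ∧ (h⁻¹ * B).charpoly = C.charpoly ∧
      (h⁻¹ * B).trace = C.trace ∧ ((h⁻¹ * B) * (h⁻¹ * B)).trace = (C * C).trace := by
  -- With h⁻¹ = KᵀK, cyclic permutation of the factors replaces KᵀKB by the symmetric matrix KBKᵀ.
  obtain ⟨K, hK⟩ := CStarAlgebra.nonneg_iff_eq_star_mul_self.mp hh.inv.nonneg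
  have hstar : star K = K.transpose := by
    rw [Matrix.star_eq_conjTranspose, Matrix.conjTranspose_eq_transpose_of_trivial]
  rw [hstar] at hK
  refine ⟨K * B * K.transpose, ?_, ?_, ?_, ?_⟩
  · rw [Matrix.IsHermitian, Matrix.conjTranspose_eq_transpose_of_trivial]
    simp [Matrix.transpose_mul, hB, Matrix.mul_assoc]
  · rw [hK, Matrix.mul_assoc, Matrix.charpoly_mul_comm]
  · rw [hK, Matrix.mul_assoc, Matrix.trace_mul_comm]
  · rw [hK, show K.transpose * K * B * (K.transpose * K * B)
      = K.transpose * (K * B * (K.transpose * K * B)) by simp only [Matrix.mul_assoc],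
      Matrix.trace_mul_comm]
    simp only [Matrix.mul_assoc]

/-- The roots are taken in ℝ, so they give the whole trace only because the characteristic
polynomial splits, being that of a symmetric matrix. -/
theorem sum_roots_charpoly_inv_mul {m : ℕ} {h B : Matrix (Fin m) (Fin m) ℝ}
    (hh : h.PosSemidef) (hB : B.transpose = B) :
    (h⁻¹ * B).charpoly.roots.sum = (h⁻¹ * B).trace := by
  obtain ⟨C, hC, h1, h2, -⟩ := exists_isHermitian_charpoly_eq hh hB
  rw [h1, h2, Matrix.trace_eq_sum_roots_charpoly_of_splits hC.splits_charpoly]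

theorem esymm_roots_charpoly_inv_mul {m : ℕ} {h B : Matrix (Fin m) (Fin m) ℝ}
    (hh : h.PosSemidef) (hB : B.transpose = B) :
    2 * (h⁻¹ * B).charpoly.roots.esymm 2
      = (h⁻¹ * B).trace ^ 2 - ((h⁻¹ * B) * (h⁻¹ * B)).trace := by
  rw [two_mul_esymm_two, sum_roots_charpoly_inv_mul hh hB]
  obtain ⟨C, hC, h1, -, h3⟩ := exists_isHermitian_charpoly_eq hh hB
  rw [h1, h3, trace_mul_self_eq_sum_sq_roots_charpoly hC]

/-- Decomposition of the inner product along a hyperplane and its unit normal. -/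
theorem inner_eq_sum_tangent_add_normal {m : ℕ} (e : Fin m → EuclideanSpace ℝ (Fin (m + 1)))
    (ν : EuclideanSpace ℝ (Fin (m + 1))) (g : Matrix (Fin m) (Fin m) ℝ)
    (hg : ∀ i j, g i j = inner ℝ (e i) (e j)) (hdet : g.det ≠ 0) (hν : inner ℝ ν ν = 1)
    (hort : ∀ i, inner ℝ (e i) ν = 0) (v w : EuclideanSpace ℝ (Fin (m + 1))) :
    inner ℝ v w = (∑ a, ∑ b, g⁻¹ a b * inner ℝ v (e a) * inner ℝ w (e b))
      + inner ℝ v ν * inner ℝ w ν := by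
  have hin : ∀ x y : EuclideanSpace ℝ (Fin (m + 1)), inner ℝ x y = ∑ a, x a * y a := fun x y => by
    simp [PiLp.inner_apply, mul_comm]
  let P : Matrix (Fin m ⊕ Unit) (Fin (m + 1)) ℝ :=
    Matrix.of fun i a => Sum.elim (fun i => e i a) (fun _ => ν a) i
  let D : Matrix (Fin m ⊕ Unit) (Fin m ⊕ Unit) ℝ := Matrix.fromBlocks g⁻¹ 0 0 1
  have hPP : P * P.transpose = Matrix.fromBlocks g 0 0 1 := by
    ext i j
    rw [Matrix.mul_apply]
    rcases i with i | i <;> rcases j with j | j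
    · simp [P, hg, hin]
    · simpa [P, hin] using hort i
    · simpa [P, hin, mul_comm] using hort j
    · rw [hin] at hν
      simpa [P] using hν
  have h1 : P * (P.transpose * D) = 1 := by
    rw [← Matrix.mul_assoc, hPP, Matrix.fromBlocks_multiply]
    simp [Matrix.mul_nonsing_inv _ (isUnit_iff_ne_zero.2 hdet)]
  -- The rows of P are the e_i and ν, m + 1 in all, so P is square up to reindexing and a right
  -- inverse is a left inverse. This is the completeness relation of the frame.
  have h2 : P.transpose * D * P = 1 :=
    (Matrix.mul_eq_one_comm_of_card_eq _ _ _ (by simp)).1 h1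
  have hP : ∀ x : EuclideanSpace ℝ (Fin (m + 1)), P.mulVec x =
      Sum.elim (fun i => inner ℝ x (e i)) (fun _ => inner ℝ x ν) := by
    intro x
    ext i
    rcases i with i | i <;> simp [P, Matrix.mulVec, dotProduct, hin, mul_comm]
  have h3 : inner ℝ v w = dotProduct (P.mulVec v) (D.mulVec (P.mulVec w)) := by
    rw [← Matrix.vecMul_transpose, ← Matrix.dotProduct_mulVec, Matrix.mulVec_mulVec,
      Matrix.mulVec_mulVec, h2, Matrix.one_mulVec, hin]
    rfl
  rw [h3, hP, hP]
  simp only [dotProduct, Matrix.mulVec, Fintype.sum_sum_type, D]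
  simp [Finset.mul_sum]
  refine Finset.sum_congr rfl fun a _ => Finset.sum_congr rfl fun b _ => by ring

/-! ### Smoothness of matrix operations -/

section MatrixCalculus

variable {m : ℕ} {E : Type*} [NormedAddCommGroup E] [NormedSpace ℝ E] {n : ℕ∞ω} {S : Set E} {u : E}
  {A : E → Matrix (Fin m) (Fin m) ℝ}

theorem contDiffWithinAt_det (hA : ∀ i j, ContDiffWithinAt ℝ n (fun v => A v i j) S u) :
    ContDiffWithinAt ℝ n (fun v => (A v).det) S u := by
  simp only [Matrix.det_apply]
  refine ContDiffWithinAt.sum fun σ _ => ContDiffWithinAt.const_smul _ ?_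
  exact contDiffWithinAt_prod fun i _ => hA _ _

theorem contDiffWithinAt_inv (hA : ∀ i j, ContDiffWithinAt ℝ n (fun v => A v i j) S u)
    (hdet : (A u).det ≠ 0) (i j : Fin m) : ContDiffWithinAt ℝ n (fun v => (A v)⁻¹ i j) S u := by
  have h1 : ContDiffWithinAt ℝ n (fun v => (A v).adjugate i j) S u := by
    simp only [Matrix.adjugate_apply]
    refine contDiffWithinAt_det fun k l => ?_
    by_cases hk : k = j
    · subst hk
      simpa using contDiffWithinAt_const
    · simpa [Matrix.updateRow_ne hk] using hA k l
  simp only [Matrix.inv_def, Ring.inverse_eq_inv', Matrix.smul_apply, smul_eq_mul]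
  exact ((contDiffWithinAt_det hA).inv hdet).mul h1

end MatrixCalculus

/-! ### Partial derivatives relative to a set -/

section PartialDeriv

variable {m : ℕ} {V W : Type*} [NormedAddCommGroup V] [NormedSpace ℝ V]
  [NormedAddCommGroup W] [NormedSpace ℝ W]
  {S : Set (EuclideanSpace ℝ (Fin m))} {u : EuclideanSpace ℝ (Fin m)}
  {F : EuclideanSpace ℝ (Fin m) → V}

theorem partialD_congr {F' : EuclideanSpace ℝ (Fin m) → V} (i : Fin m) (hu : u ∈ S)
    (h : F =ᶠ[𝓝[S] u] F') : partialD S i F u = partialD S i F' u := by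
  unfold partialD
  rw [h.fderivWithin_eq_of_mem hu]

theorem partialD_eq_of_hasFDerivWithinAt {F' : EuclideanSpace ℝ (Fin m) →L[ℝ] V}
    (h : HasFDerivWithinAt F F' S u) (hS : UniqueDiffOn ℝ S) (hu : u ∈ S) (i : Fin m) :
    partialD S i F u = F' (EuclideanSpace.single i 1) := by
  unfold partialD
  rw [h.fderivWithin (hS u hu)]

theorem contDiffWithinAt_partialD (hS : UniqueDiffOn ℝ S) (hu : u ∈ S) (i : Fin m)
    (hF : ContDiffWithinAt ℝ ∞ F S u) : ContDiffWithinAt ℝ ∞ (partialD S i F) S u :=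
  (hF.fderivWithin_right hS (m := ∞) le_rfl hu).clm_apply contDiffWithinAt_const

/-- At a boundary point of S the symmetry of the second derivative is a limit of the symmetry at
interior points, whence the condition that u lie in the closure of the interior. -/
theorem partialD_comm (hS : UniqueDiffOn ℝ S) (hu : u ∈ S) (hcl : u ∈ closure (interior S))
    (hF : ContDiffWithinAt ℝ ∞ F S u) (i j : Fin m) :
    partialD S i (partialD S j F) u = partialD S j (partialD S i F) u := by
  have hd : DifferentiableWithinAt ℝ (fderivWithin ℝ F S) S u :=
    (hF.fderivWithin_right hS (m := ∞) le_rfl hu).differentiableWithinAt (by simp)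
  have h : ∀ i j, partialD S i (partialD S j F) u = fderivWithin ℝ (fderivWithin ℝ F S) S u
      (EuclideanSpace.single i 1) (EuclideanSpace.single j 1) := fun i j => by
    refine (partialD_eq_of_hasFDerivWithinAt
      (hd.hasFDerivWithinAt.clm_apply (hasFDerivWithinAt_const _ u S)) hS hu i).trans ?_
    simp
  rw [h, h]
  refine (hF.isSymmSndFDerivWithinAt ?_ hS hcl hu).eq _ _
  rw [minSmoothness_of_isRCLikeNormedField]
  exact WithTop.coe_le_coe.2 le_top

theorem partialD_add {P Q : EuclideanSpace ℝ (Fin m) → V} (hS : UniqueDiffOn ℝ S) (hu : u ∈ S)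
    (hP : DifferentiableWithinAt ℝ P S u) (hQ : DifferentiableWithinAt ℝ Q S u) (i : Fin m) :
    partialD S i (fun v => P v + Q v) u = partialD S i P u + partialD S i Q u :=
  partialD_eq_of_hasFDerivWithinAt (hP.hasFDerivWithinAt.add hQ.hasFDerivWithinAt) hS hu i

theorem partialD_sum {ι : Type*} (s : Finset ι) {P : ι → EuclideanSpace ℝ (Fin m) → V}
    (hS : UniqueDiffOn ℝ S) (hu : u ∈ S) (hP : ∀ a ∈ s, DifferentiableWithinAt ℝ (P a) S u)
    (i : Fin m) : partialD S i (fun v => ∑ a ∈ s, P a v) u = ∑ a ∈ s, partialD S i (P a) u := by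
  rw [partialD_eq_of_hasFDerivWithinAt
    (HasFDerivWithinAt.fun_sum fun a ha => (hP a ha).hasFDerivWithinAt) hS hu i]
  simp [partialD]

theorem partialD_clm (L : V →L[ℝ] W) (hS : UniqueDiffOn ℝ S) (hu : u ∈ S)
    (hF : DifferentiableWithinAt ℝ F S u) (i : Fin m) :
    partialD S i (fun v => L (F v)) u = L (partialD S i F u) :=
  partialD_eq_of_hasFDerivWithinAt
    (L.hasFDerivAt.comp_hasFDerivWithinAt u hF.hasFDerivWithinAt) hS hu i

theorem partialD_bilin (β : V →L[ℝ] V →L[ℝ] W) {P Q : EuclideanSpace ℝ (Fin m) → V}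
    (hS : UniqueDiffOn ℝ S) (hu : u ∈ S) (hP : DifferentiableWithinAt ℝ P S u)
    (hQ : DifferentiableWithinAt ℝ Q S u) (i : Fin m) :
    partialD S i (fun v => β (P v) (Q v)) u
      = β (partialD S i P u) (Q u) + β (P u) (partialD S i Q u) := by
  rw [partialD_eq_of_hasFDerivWithinAt (β.hasFDerivWithinAt_of_bilinear hP.hasFDerivWithinAt
    hQ.hasFDerivWithinAt) hS hu i]
  simp [partialD, add_comm]

theorem partialD_smul {c : EuclideanSpace ℝ (Fin m) → ℝ} {Q : EuclideanSpace ℝ (Fin m) → V}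
    (hS : UniqueDiffOn ℝ S) (hu : u ∈ S) (hc : DifferentiableWithinAt ℝ c S u)
    (hQ : DifferentiableWithinAt ℝ Q S u) (i : Fin m) :
    partialD S i (fun v => c v • Q v) u = partialD S i c u • Q u + c u • partialD S i Q u := by
  refine (partialD_eq_of_hasFDerivWithinAt
    (hc.hasFDerivWithinAt.smul hQ.hasFDerivWithinAt) hS hu i).trans ?_
  simp [partialD, add_comm]

theorem partialD_mul {P Q : EuclideanSpace ℝ (Fin m) → ℝ}
    (hS : UniqueDiffOn ℝ S) (hu : u ∈ S) (hP : DifferentiableWithinAt ℝ P S u)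
    (hQ : DifferentiableWithinAt ℝ Q S u) (i : Fin m) :
    partialD S i (fun v => P v * Q v) u = partialD S i P u * Q u + P u * partialD S i Q u :=
  partialD_smul hS hu hP hQ i

end PartialDeriv

/-! ### The Gauss equation for immersions into a flat space -/

section FlatGauss

variable {m : ℕ} {V : Type*} [NormedAddCommGroup V] [NormedSpace ℝ V]
  {S : Set (EuclideanSpace ℝ (Fin m))} {u : EuclideanSpace ℝ (Fin m)}
  {Φ : EuclideanSpace ℝ (Fin m) → V} {β : V →L[ℝ] V →L[ℝ] ℝ} {h : MetricField m}

theorem partialD_flatMetric (hS : UniqueDiffOn ℝ S) (hu : u ∈ S)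
    (hβ : ∀ v w, β v w = β w v) (hΦ : ContDiffWithinAt ℝ ∞ Φ S u)
    (hh : ∀ᶠ v in 𝓝[S] u, ∀ i j, h v i j = β (partialD S i Φ v) (partialD S j Φ v))
    (i j k : Fin m) :
    partialD S i (fun v => h v j k) u
      = β (partialD S i (partialD S j Φ) u) (partialD S k Φ u)
        + β (partialD S i (partialD S k Φ) u) (partialD S j Φ u) := by
  have hd : ∀ j, DifferentiableWithinAt ℝ (partialD S j Φ) S u := fun j =>
    (contDiffWithinAt_partialD hS hu j hΦ).differentiableWithinAt (by simp)
  rw [partialD_congr i hu (hh.mono fun v hv => hv j k), partialD_bilin β hS hu (hd j) (hd k),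
    hβ (partialD S j Φ u)]

/-- The three metric derivatives produce six pairings of a second with a first derivative of Φ. By
symmetry of second derivatives four cancel and the other two coincide. -/
theorem christoffel_flatMetric (hS : UniqueDiffOn ℝ S) (hu : u ∈ S)
    (hcl : u ∈ closure (interior S)) (hβ : ∀ v w, β v w = β w v)
    (hΦ : ContDiffWithinAt ℝ ∞ Φ S u)
    (hh : ∀ᶠ v in 𝓝[S] u, ∀ i j, h v i j = β (partialD S i Φ v) (partialD S j Φ v))
    (k i j : Fin m) :
    christoffel S h k i j u
      = ∑ l, (h u)⁻¹ k l * β (partialD S i (partialD S j Φ) u) (partialD S l Φ u) := by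
  unfold christoffel
  rw [Finset.mul_sum]
  refine Finset.sum_congr rfl fun l _ => ?_
  rw [partialD_flatMetric hS hu hβ hΦ hh, partialD_flatMetric hS hu hβ hΦ hh,
    partialD_flatMetric hS hu hβ hΦ hh, partialD_comm hS hu hcl hΦ j i,
    partialD_comm hS hu hcl hΦ l i, partialD_comm hS hu hcl hΦ l j]
  ring

/-- Gauss equation without a normal: the curvature is the antisymmetrized pairing of second
derivatives minus its tangential part. No positivity or nondegeneracy of β is used, only
invertibility of the induced metric, so the same statement serves Euclidean and Minkowski space and
any codimension. -/
theorem riemann_flatMetric (hS : UniqueDiffOn ℝ S) (hu : u ∈ S)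
    (hcl : S ⊆ closure (interior S)) (hβ : ∀ v w, β v w = β w v)
    (hΦ : ∀ᶠ v in 𝓝[S] u, ContDiffWithinAt ℝ ∞ Φ S v)
    (hh : ∀ᶠ v in 𝓝[S] u, ∀ i j, h v i j = β (partialD S i Φ v) (partialD S j Φ v))
    (hdet : (h u).det ≠ 0) (i j k l : Fin m) :
    riemann S h i j k l u
      = β (partialD S i (partialD S k Φ) u) (partialD S j (partialD S l Φ) u)
        - β (partialD S j (partialD S k Φ) u) (partialD S i (partialD S l Φ) u)
        - (∑ a, ∑ b, (h u)⁻¹ a b * β (partialD S i (partialD S k Φ) u) (partialD S a Φ u)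
            * β (partialD S j (partialD S l Φ) u) (partialD S b Φ u)
          - ∑ a, ∑ b, (h u)⁻¹ a b * β (partialD S j (partialD S k Φ) u) (partialD S a Φ u)
            * β (partialD S i (partialD S l Φ) u) (partialD S b Φ u)) := by
  have hΦu := hΦ.self_of_nhdsWithin hu
  have hs1 : ∀ j, ContDiffWithinAt ℝ ∞ (partialD S j Φ) S u := fun j =>
    contDiffWithinAt_partialD hS hu j hΦu
  have hs2 : ∀ j l, ContDiffWithinAt ℝ ∞ (partialD S j (partialD S l Φ)) S u := fun j l =>
    contDiffWithinAt_partialD hS hu j (hs1 l)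
  have hbil : ∀ {P Q : EuclideanSpace ℝ (Fin m) → V}, ContDiffWithinAt ℝ ∞ P S u →
      ContDiffWithinAt ℝ ∞ Q S u → ContDiffWithinAt ℝ ∞ (fun v => β (P v) (Q v)) S u :=
    fun hP hQ => (contDiffWithinAt_const.clm_apply hP).clm_apply hQ
  have hsh : ∀ i j, ContDiffWithinAt ℝ ∞ (fun v => h v i j) S u := fun i j =>
    (hbil (hs1 i) (hs1 j)).congr_of_eventuallyEq_of_mem (hh.mono fun v hv => hv i j) hu
  have hΓ : ∀ᶠ v in 𝓝[S] u, ∀ k i j, christoffel S h k i j v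
      = ∑ l, (h v)⁻¹ k l * β (partialD S i (partialD S j Φ) v) (partialD S l Φ v) := by
    filter_upwards [hΦ, eventually_eventually_nhdsWithin.2 hh, self_mem_nhdsWithin]
      with v hv hhv hvS k i j
    exact christoffel_flatMetric hS hvS (hcl hvS) hβ hv hhv k i j
  have hΓd : ∀ k i j, DifferentiableWithinAt ℝ (christoffel S h k i j) S u := by
    intro k i j
    have : ContDiffWithinAt ℝ ∞ (christoffel S h k i j) S u := by
      refine ContDiffWithinAt.congr_of_eventuallyEq_of_mem ?_ (hΓ.mono fun v hv => hv k i j) hu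
      exact ContDiffWithinAt.sum fun l _ =>
        (contDiffWithinAt_inv hsh hdet k l).mul (hbil (hs2 i j) (hs1 l))
    exact this.differentiableWithinAt (by simp)
  -- Christoffel symbols with the upper index lowered contain no inverse metric. Differentiating
  -- this identity avoids differentiating the inverse, which is why it is needed near u and not only
  -- at u.
  have hlow : ∀ᶠ v in 𝓝[S] u, ∀ k i j, ∑ a, h v k a * christoffel S h a i j v
      = β (partialD S i (partialD S j Φ) v) (partialD S k Φ v) := by
    have hdet' : ∀ᶠ v in 𝓝[S] u, (h v).det ≠ 0 :=
      (contDiffWithinAt_det hsh).continuousWithinAt.eventually_ne hdet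
    filter_upwards [hΓ, hdet'] with v hv hdv k i j
    have h1 : ∀ c : Fin m → ℝ, (h v).mulVec ((h v)⁻¹.mulVec c) k = c k := fun c => by
      rw [Matrix.mulVec_mulVec, Matrix.mul_nonsing_inv _ (isUnit_iff_ne_zero.2 hdv),
        Matrix.one_mulVec]
    rw [← h1 fun l => β (partialD S i (partialD S j Φ) v) (partialD S l Φ v)]
    simp only [Matrix.mulVec, dotProduct, hv]
  have hkey : ∀ i k j l, ∑ a, h u k a * partialD S i (christoffel S h a j l) u
      = β (partialD S i (partialD S j (partialD S l Φ)) u) (partialD S k Φ u)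
        + β (partialD S j (partialD S l Φ) u) (partialD S i (partialD S k Φ) u)
        - ∑ a, (β (partialD S i (partialD S k Φ) u) (partialD S a Φ u)
          + β (partialD S i (partialD S a Φ) u) (partialD S k Φ u)) * christoffel S h a j l u := by
    intro i k j l
    have h1 := partialD_congr i hu (hlow.mono fun v hv => hv k j l)
    rw [partialD_bilin β hS hu ((hs2 j l).differentiableWithinAt (by simp))
      ((hs1 k).differentiableWithinAt (by simp)), partialD_sum Finset.univ hS hu
      (P := fun a v => h v k a * christoffel S h a j l v)
      (fun a _ => ((hsh k a).differentiableWithinAt (by simp)).mul (hΓd a j l))] at h1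
    rw [← h1, eq_sub_iff_add_eq, ← Finset.sum_add_distrib]
    refine Finset.sum_congr rfl fun a _ => ?_
    rw [partialD_mul hS hu ((hsh k a).differentiableWithinAt (by simp)) (hΓd a j l),
      partialD_flatMetric hS hu hβ hΦu hh]
    ring
  have hlowu := hlow.self_of_nhdsWithin hu
  have hΓu := hΓ.self_of_nhdsWithin hu
  have hquad : ∀ i j, ∑ a, h u k a * ∑ b, christoffel S h a i b u * christoffel S h b j l u
      = ∑ b, β (partialD S i (partialD S b Φ) u) (partialD S k Φ u) * christoffel S h b j l u := by
    intro i j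
    simp only [Finset.mul_sum, ← mul_assoc]
    rw [Finset.sum_comm]
    refine Finset.sum_congr rfl fun b _ => ?_
    rw [← Finset.sum_mul, hlowu]
  have hfin : ∀ i j, ∑ a, ∑ b, (h u)⁻¹ a b
        * β (partialD S i (partialD S k Φ) u) (partialD S a Φ u)
        * β (partialD S j (partialD S l Φ) u) (partialD S b Φ u)
      = ∑ a, β (partialD S i (partialD S k Φ) u) (partialD S a Φ u) * christoffel S h a j l u := by
    intro i j
    refine Finset.sum_congr rfl fun a _ => ?_
    rw [hΓu, Finset.mul_sum]
    exact Finset.sum_congr rfl fun b _ => by ring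
  -- The third derivatives of Φ are symmetric in i and j, so they drop out of the antisymmetrized
  -- expression.
  have hthird : partialD S i (partialD S j (partialD S l Φ)) u
      = partialD S j (partialD S i (partialD S l Φ)) u :=
    partialD_comm hS hu (hcl hu) (hs1 l) i j
  rw [hfin, hfin]
  unfold riemann
  simp only [mul_add, mul_sub, Finset.sum_add_distrib, Finset.sum_sub_distrib]
  rw [hquad, hquad, hkey, hkey, hthird]
  simp only [add_mul, Finset.sum_add_distrib]
  rw [hβ (partialD S j (partialD S l Φ) u), hβ (partialD S i (partialD S l Φ) u)]
  ring

end FlatGauss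

/-! ### The Euclidean and the hyperbolic metric -/

theorem inner_eq_sum_mul {N : ℕ} (x y : EuclideanSpace ℝ (Fin N)) :
    inner ℝ x y = ∑ a, x a * y a := by
  simp [PiLp.inner_apply, mul_comm]

theorem euclideanMetric_pair {N : ℕ} (p v w : EuclideanSpace ℝ (Fin N)) :
    (euclideanMetric N).pair p v w = inner ℝ v w := by
  simp [MetricField.pair, euclideanMetric, Matrix.one_apply, inner_eq_sum_mul]

theorem hyperbolicMetric_pair {m : ℕ} (p v w : EuclideanSpace ℝ (Fin (m + 1))) :
    (hyperbolicMetric m).pair p v w = (p (Fin.last m))⁻¹ ^ 2 * inner ℝ v w := by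
  simp [MetricField.pair, hyperbolicMetric, Matrix.one_apply, inner_eq_sum_mul,
    Finset.mul_sum, mul_assoc]

/-- The unit vector in the direction of the last coordinate. -/
def verticalUnit (m : ℕ) : EuclideanSpace ℝ (Fin (m + 1)) := EuclideanSpace.single (Fin.last m) 1

theorem inner_verticalUnit {m : ℕ} (v : EuclideanSpace ℝ (Fin (m + 1))) :
    inner ℝ v (verticalUnit m) = v (Fin.last m) := by
  simp [verticalUnit, EuclideanSpace.inner_single_right]

theorem verticalUnit_last (m : ℕ) : verticalUnit m (Fin.last m) = 1 := by
  simp [verticalUnit]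

theorem christoffel_euclideanMetric {N : ℕ} (a b c : Fin N) (p : EuclideanSpace ℝ (Fin N)) :
    christoffel Set.univ (euclideanMetric N) a b c p = 0 := by
  simp [christoffel, euclideanMetric, partialD]

theorem partialD_hyperbolicMetric {m : ℕ} {p : EuclideanSpace ℝ (Fin (m + 1))}
    (hp : p (Fin.last m) ≠ 0) (i j l : Fin (m + 1)) :
    partialD Set.univ i (fun v => hyperbolicMetric m v j l) p
      = -2 * (p (Fin.last m))⁻¹ ^ 3 * (verticalUnit m i) * (1 : Matrix _ _ ℝ) j l := by
  have h1 : HasFDerivAt (fun v : EuclideanSpace ℝ (Fin (m + 1)) => v (Fin.last m))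
      (EuclideanSpace.proj (Fin.last m) : EuclideanSpace ℝ (Fin (m + 1)) →L[ℝ] ℝ) p :=
    (EuclideanSpace.proj (Fin.last m) : EuclideanSpace ℝ (Fin (m + 1)) →L[ℝ] ℝ).hasFDerivAt
  have h2 : HasDerivAt (fun x : ℝ => 1 / x ^ 2 * (1 : Matrix _ _ ℝ) j l)
      (-2 * (p (Fin.last m))⁻¹ ^ 3 * (1 : Matrix _ _ ℝ) j l) (p (Fin.last m)) := by
    have := (((hasDerivAt_pow 2 (p (Fin.last m))).inv (pow_ne_zero 2 hp)).mul_const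
      ((1 : Matrix (Fin (m + 1)) (Fin (m + 1)) ℝ) j l))
    simp only [one_div]
    refine this.congr_deriv ?_
    simp only [Nat.cast_ofNat, Nat.add_one_sub_one, pow_one]
    field_simp
  have h3 := (h2.comp_hasFDerivAt p h1).hasFDerivWithinAt (s := Set.univ)
  refine (partialD_eq_of_hasFDerivWithinAt h3 uniqueDiffOn_univ trivial i).trans ?_
  have h4 : (EuclideanSpace.single i (1 : ℝ) : EuclideanSpace ℝ (Fin (m + 1))) (Fin.last m)
      = verticalUnit m i := by
    simp [verticalUnit, eq_comm]
  simp only [smul_apply, EuclideanSpace.coe_proj, h4, smul_eq_mul]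
  ring

/-- The metric is z^(-2) times a constant one, so only the derivative of the conformal factor in the
z direction contributes. -/
theorem christoffel_hyperbolicMetric {m : ℕ} {p : EuclideanSpace ℝ (Fin (m + 1))}
    (hp : p (Fin.last m) ≠ 0) (a b c : Fin (m + 1)) :
    christoffel Set.univ (hyperbolicMetric m) a b c p
      = -(p (Fin.last m))⁻¹ * ((1 : Matrix _ _ ℝ) a c * verticalUnit m b
        + (1 : Matrix _ _ ℝ) a b * verticalUnit m c
        - (1 : Matrix _ _ ℝ) b c * verticalUnit m a) := by
  have hinv : (hyperbolicMetric m p)⁻¹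
      = (p (Fin.last m) ^ 2) • (1 : Matrix (Fin (m + 1)) (Fin (m + 1)) ℝ) := by
    apply Matrix.inv_eq_left_inv
    simp [hyperbolicMetric, smul_smul, hp]
  unfold christoffel
  simp only [partialD_hyperbolicMetric hp, hinv, Matrix.smul_apply, smul_eq_mul]
  rw [Finset.sum_eq_single a (fun l _ hl => by simp [Matrix.one_apply_ne hl.symm]) (by simp)]
  have h1 : (1 : Matrix (Fin (m + 1)) (Fin (m + 1)) ℝ) c a = (1 : Matrix _ _ ℝ) a c := by
    simp [Matrix.one_apply, eq_comm]
  have h2 : (1 : Matrix (Fin (m + 1)) (Fin (m + 1)) ℝ) b a = (1 : Matrix _ _ ℝ) a b := by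
    simp [Matrix.one_apply, eq_comm]
  rw [h1, h2, Matrix.one_apply_eq]
  field_simp
  ring

/-! ### The hyperboloid model -/

/-- The inner product of a real inner product space as a continuous bilinear map. -/
def realInner (E : Type*) [NormedAddCommGroup E] [InnerProductSpace ℝ E] : E →L[ℝ] E →L[ℝ] ℝ :=
  (isBoundedBilinearMap_inner (𝕜 := ℝ) (E := E)).toContinuousLinearMap

theorem realInner_apply {E : Type*} [NormedAddCommGroup E] [InnerProductSpace ℝ E] (x y : E) :
    realInner E x y = inner ℝ x y := rfl

/-- The Minkowski space in which the hyperbolic space is realized as a hyperboloid, with two null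
coordinates; the vertical component of the middle factor plays no role. -/
abbrev Minkowski (m : ℕ) : Type := ℝ × EuclideanSpace ℝ (Fin (m + 1)) × ℝ

/-- The Minkowski form. -/
def minkowskiForm (m : ℕ) : Minkowski m →L[ℝ] Minkowski m →L[ℝ] ℝ :=
  let π₁ : Minkowski m →L[ℝ] ℝ := ContinuousLinearMap.fst ℝ _ _
  let π₂ : Minkowski m →L[ℝ] EuclideanSpace ℝ (Fin (m + 1)) :=
    ContinuousLinearMap.fst ℝ _ _ ∘L ContinuousLinearMap.snd ℝ _ _
  let π₃ : Minkowski m →L[ℝ] ℝ := ContinuousLinearMap.snd ℝ _ _ ∘L ContinuousLinearMap.snd ℝ _ _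
  let ζ : Minkowski m →L[ℝ] ℝ := EuclideanSpace.proj (Fin.last m) ∘L π₂
  let μ := ContinuousLinearMap.mul ℝ ℝ
  (realInner _).bilinearComp π₂ π₂ - μ.bilinearComp ζ ζ
    - (1 / 2 : ℝ) • (μ.bilinearComp π₁ π₃ + μ.bilinearComp π₃ π₁)

theorem minkowskiForm_apply {m : ℕ} (v w : Minkowski m) :
    minkowskiForm m v w = inner ℝ v.2.1 w.2.1 - v.2.1 (Fin.last m) * w.2.1 (Fin.last m)
      - 1 / 2 * (v.1 * w.2.2 + v.2.2 * w.1) := by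
  simp [minkowskiForm, realInner_apply]
  ring

theorem minkowskiForm_comm {m : ℕ} (v w : Minkowski m) :
    minkowskiForm m v w = minkowskiForm m w v := by
  rw [minkowskiForm_apply, minkowskiForm_apply, real_inner_comm]
  ring

/-- The point of the hyperboloid corresponding to a point of the upper half-space. -/
def hyperboloidMap (m : ℕ) (p : EuclideanSpace ℝ (Fin (m + 1))) : Minkowski m :=
  ((p (Fin.last m))⁻¹, (p (Fin.last m))⁻¹ • p, (p (Fin.last m))⁻¹ * inner ℝ p p)

/-- The first derivative of `hyperboloidMap` along a map with value `p` and derivative `v`. -/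
def hyperboloidFirst (m : ℕ) (p v : EuclideanSpace ℝ (Fin (m + 1))) : Minkowski m :=
  let w := (p (Fin.last m))⁻¹
  let w₁ := -w ^ 2 * v (Fin.last m)
  (w₁, w₁ • p + w • v, w₁ * inner ℝ p p + w * (2 * inner ℝ p v))

/-- The second derivative of `hyperboloidMap` along a map with value `p`, first derivatives `v, v'`
and second derivative `a`. -/
def hyperboloidSecond (m : ℕ) (p v v' a : EuclideanSpace ℝ (Fin (m + 1))) : Minkowski m :=
  let w := (p (Fin.last m))⁻¹
  let w₁ := -w ^ 2 * v (Fin.last m)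
  let w₂ := -w ^ 2 * v' (Fin.last m)
  let w₃ := 2 * w ^ 3 * v (Fin.last m) * v' (Fin.last m) - w ^ 2 * a (Fin.last m)
  (w₃, (w₃ • p + w₂ • v) + (w₁ • v' + w • a),
    (w₃ * inner ℝ p p + w₂ * (2 * inner ℝ p v))
      + (w₁ * (2 * inner ℝ p v') + w * (2 * (inner ℝ v v' + inner ℝ p a))))

/-- The covariant derivative in the upper half-space, for a map with first derivatives `v, v'` and
second derivative `a`. -/
def hyperbolicHessian (m : ℕ) (p v v' a : EuclideanSpace ℝ (Fin (m + 1))) :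
    EuclideanSpace ℝ (Fin (m + 1)) :=
  a - (p (Fin.last m))⁻¹ • (v' (Fin.last m) • v + v (Fin.last m) • v' - inner ℝ v v' • verticalUnit m)

section Algebra

variable {m : ℕ} {p : EuclideanSpace ℝ (Fin (m + 1))}

/-- The vertical component of p/z is constantly 1, so its derivatives vanish. This removes the
degenerate direction of the Minkowski form from the later computations. -/
theorem hyperboloidFirst_last (hp : p (Fin.last m) ≠ 0)
    (v : EuclideanSpace ℝ (Fin (m + 1))) : (hyperboloidFirst m p v).2.1 (Fin.last m) = 0 := by
  simp [hyperboloidFirst]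
  field_simp
  ring

theorem hyperboloidSecond_last (hp : p (Fin.last m) ≠ 0)
    (v v' a : EuclideanSpace ℝ (Fin (m + 1))) : (hyperboloidSecond m p v v' a).2.1 (Fin.last m) = 0 := by
  simp [hyperboloidSecond]
  field_simp
  ring

/-- The lift to the hyperboloid is isometric. -/
theorem minkowskiForm_first_first (hp : p (Fin.last m) ≠ 0)
    (v x : EuclideanSpace ℝ (Fin (m + 1))) :
    minkowskiForm m (hyperboloidFirst m p v) (hyperboloidFirst m p x)
      = (p (Fin.last m))⁻¹ ^ 2 * inner ℝ v x := by
  rw [minkowskiForm_apply, hyperboloidFirst_last hp, zero_mul]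
  simp only [hyperboloidFirst, inner_add_left, inner_add_right, real_inner_smul_left,
    real_inner_smul_right]
  rw [real_inner_comm p v]
  ring

theorem minkowskiForm_second_first (hp : p (Fin.last m) ≠ 0)
    (v v' a x : EuclideanSpace ℝ (Fin (m + 1))) :
    minkowskiForm m (hyperboloidSecond m p v v' a) (hyperboloidFirst m p x)
      = (p (Fin.last m))⁻¹ ^ 2 * inner ℝ (hyperbolicHessian m p v v' a) x := by
  rw [minkowskiForm_apply, hyperboloidFirst_last hp, mul_zero]
  simp only [hyperboloidFirst, hyperboloidSecond, hyperbolicHessian, inner_add_left,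
    inner_sub_left, inner_add_right, real_inner_smul_left, real_inner_smul_right]
  rw [real_inner_comm p v, real_inner_comm p v', real_inner_comm p a,
    real_inner_comm x (verticalUnit m), inner_verticalUnit]
  ring

/-- On the hyperboloid, where the position vector has square −1, a second derivative of the lift is
the image of the hyperbolic covariant derivative plus g(v, v') times the position vector. The last
product is the contribution of that normal direction; it becomes the curvature −1 in the Gauss
equation. -/
theorem minkowskiForm_second_second (hp : p (Fin.last m) ≠ 0)
    (v v' a x x' b : EuclideanSpace ℝ (Fin (m + 1))) :
    minkowskiForm m (hyperboloidSecond m p v v' a) (hyperboloidSecond m p x x' b)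
      = (p (Fin.last m))⁻¹ ^ 2 * inner ℝ (hyperbolicHessian m p v v' a)
          (hyperbolicHessian m p x x' b)
        - ((p (Fin.last m))⁻¹ ^ 2 * inner ℝ v v') * ((p (Fin.last m))⁻¹ ^ 2 * inner ℝ x x') := by
  rw [minkowskiForm_apply, hyperboloidSecond_last hp, zero_mul]
  simp only [hyperboloidSecond, hyperbolicHessian, inner_add_left, inner_add_right,
    inner_sub_left, inner_sub_right, real_inner_smul_left, real_inner_smul_right]
  rw [real_inner_comm p v, real_inner_comm p v', real_inner_comm p a,
    real_inner_comm x (verticalUnit m), real_inner_comm x' (verticalUnit m),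
    real_inner_comm b (verticalUnit m)]
  simp only [inner_verticalUnit, verticalUnit_last]
  ring

end Algebra

/-! ### Double traces -/

section Traces

variable {m : ℕ} (N : Matrix (Fin m) (Fin m) ℝ) {X : Matrix (Fin m) (Fin m) ℝ}

theorem sum_mul_eq_trace_sq (hX : X.transpose = X) :
    ∑ i, ∑ j, ∑ k, ∑ l, N i k * N j l * (X i k * X j l) = (N * X).trace ^ 2 := by
  have h : (N * X).trace = ∑ i, ∑ k, N i k * X i k := by
    simp only [Matrix.trace, Matrix.diag, Matrix.mul_apply]
    refine Finset.sum_congr rfl fun i _ => Finset.sum_congr rfl fun k _ => ?_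
    rw [← Matrix.transpose_apply X i k, hX]
  rw [h, sq, Finset.sum_mul_sum]
  refine Finset.sum_congr rfl fun i _ => Finset.sum_congr rfl fun j _ => ?_
  rw [Finset.sum_mul_sum]
  exact Finset.sum_congr rfl fun k _ => Finset.sum_congr rfl fun l _ => by ring

theorem sum_mul_eq_trace_mul_self (hX : X.transpose = X) :
    ∑ i, ∑ j, ∑ k, ∑ l, N i k * N j l * (X j k * X i l) = ((N * X) * (N * X)).trace := by
  simp only [Matrix.trace, Matrix.diag, Matrix.mul_apply]
  refine Finset.sum_congr rfl fun i _ => Finset.sum_congr rfl fun j _ => ?_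
  rw [Finset.sum_mul_sum]
  refine Finset.sum_congr rfl fun k _ => Finset.sum_congr rfl fun l _ => ?_
  rw [← Matrix.transpose_apply X j k, ← Matrix.transpose_apply X i l, hX]
  ring

theorem scalarCurvatureAt_of_gauss {m : ℕ} {S : Set (EuclideanSpace ℝ (Fin m))}
    {h : MetricField m} {u : EuclideanSpace ℝ (Fin m)} {B : Matrix (Fin m) (Fin m) ℝ} {ε : ℝ}
    (hdet : (h u).det ≠ 0) (hh : (h u).transpose = h u) (hB : B.transpose = B)
    (hR : ∀ i j k l, riemann S h i j k l u
      = B i k * B j l - B j k * B i l + ε * (h u i k * h u j l - h u j k * h u i l)) :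
    scalarCurvatureAt S h u = 1 / ((m : ℝ) * ((m : ℝ) - 1)) *
      (((h u)⁻¹ * B).trace ^ 2 - (((h u)⁻¹ * B) * ((h u)⁻¹ * B)).trace
        + ε * ((m : ℝ) ^ 2 - m)) := by
  unfold scalarCurvatureAt
  have h1 : (h u)⁻¹ * h u = 1 := Matrix.nonsing_inv_mul _ (isUnit_iff_ne_zero.2 hdet)
  -- The curvature term of the ambient space has the shape of the B terms with B replaced by the
  -- metric, whose product with the inverse is 1; the two double traces are then m² and m.
  have e1 := sum_mul_eq_trace_sq (h u)⁻¹ hh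
  have e2 := sum_mul_eq_trace_mul_self (h u)⁻¹ hh
  rw [h1, Matrix.trace_one, Fintype.card_fin] at e1
  rw [h1, mul_one, Matrix.trace_one, Fintype.card_fin] at e2
  have e3 := sum_mul_eq_trace_sq (h u)⁻¹ hB
  have e4 := sum_mul_eq_trace_mul_self (h u)⁻¹ hB
  have key : ∀ p q r s : Fin m → Fin m → Fin m → Fin m → ℝ,
      ∑ i, ∑ j, ∑ k, ∑ l, (p i j k l - q i j k l + ε * (r i j k l - s i j k l))
        = ∑ i, ∑ j, ∑ k, ∑ l, p i j k l - ∑ i, ∑ j, ∑ k, ∑ l, q i j k l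
          + ε * (∑ i, ∑ j, ∑ k, ∑ l, r i j k l - ∑ i, ∑ j, ∑ k, ∑ l, s i j k l) := by
    intro p q r s
    simp only [Finset.sum_add_distrib, Finset.sum_sub_distrib, mul_sub, Finset.mul_sum]
  rw [← e3, ← e4, congrArg₂ (· - ·) e1.symm e2.symm, ← key]
  congr 1
  refine Finset.sum_congr rfl fun i _ => Finset.sum_congr rfl fun j _ =>
    Finset.sum_congr rfl fun k _ => Finset.sum_congr rfl fun l _ => ?_
  rw [hR]
  ring

end Traces

/-! ### Induced metric and second fundamental form -/

section Forms

variable {m : ℕ} {S : Set (EuclideanSpace ℝ (Fin m))} {u : EuclideanSpace ℝ (Fin m)}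
  {F : EuclideanSpace ℝ (Fin m) → EuclideanSpace ℝ (Fin (m + 1))}

theorem inducedMetric_euclideanMetric (i j : Fin m) :
    inducedMetric (euclideanMetric (m + 1)) S F u i j
      = inner ℝ (partialD S i F u) (partialD S j F u) := by
  simp [inducedMetric, euclideanMetric_pair]

theorem inducedMetric_hyperbolicMetric (i j : Fin m) :
    inducedMetric (hyperbolicMetric m) S F u i j
      = (F u (Fin.last m))⁻¹ ^ 2 * inner ℝ (partialD S i F u) (partialD S j F u) := by
  simp [inducedMetric, hyperbolicMetric_pair]

theorem inducedMetric_hyperbolicMetric_eq_smul :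
    inducedMetric (hyperbolicMetric m) S F u
      = (F u (Fin.last m))⁻¹ ^ 2 • inducedMetric (euclideanMetric (m + 1)) S F u := by
  ext i j
  rw [inducedMetric_hyperbolicMetric, Matrix.smul_apply, inducedMetric_euclideanMetric,
    smul_eq_mul]

theorem covariantHessian_euclideanMetric (i j : Fin m) :
    covariantHessian (euclideanMetric (m + 1)) S F i j u = partialD S i (partialD S j F) u := by
  ext a
  simp [covariantHessian, christoffel_euclideanMetric]

theorem covariantHessian_hyperbolicMetric (hF : F u (Fin.last m) ≠ 0) (i j : Fin m) :
    covariantHessian (hyperbolicMetric m) S F i j u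
      = hyperbolicHessian m (F u) (partialD S i F u) (partialD S j F u)
          (partialD S i (partialD S j F) u) := by
  ext a
  have hz : ∀ v : EuclideanSpace ℝ (Fin (m + 1)), ∑ b, verticalUnit m b * v b = v (Fin.last m) :=
    fun v => by rw [← inner_eq_sum_mul, real_inner_comm, inner_verticalUnit]
  have h1 : ∀ v : EuclideanSpace ℝ (Fin (m + 1)), ∑ b, (1 : Matrix _ _ ℝ) a b * v b = v a :=
    fun v => by simp [Matrix.one_apply]
  have h2 : ∀ v w : EuclideanSpace ℝ (Fin (m + 1)),
      ∑ b, ∑ c, christoffel Set.univ (hyperbolicMetric m) a b c (F u) * v b * w c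
        = -(F u (Fin.last m))⁻¹ * (v (Fin.last m) * w a + v a * w (Fin.last m)
          - inner ℝ v w * verticalUnit m a) := by
    intro v w
    have h3 : inner ℝ v w = ∑ b, ∑ c, (1 : Matrix _ _ ℝ) b c * v b * w c := by
      simp [Matrix.one_apply, inner_eq_sum_mul]
    rw [← hz v, ← hz w, ← h1 v, ← h1 w, h3, Finset.sum_mul_sum, Finset.sum_mul_sum,
      Finset.sum_mul, ← Finset.sum_add_distrib, ← Finset.sum_sub_distrib, Finset.mul_sum]
    refine Finset.sum_congr rfl fun b _ => ?_
    rw [Finset.sum_mul, ← Finset.sum_add_distrib, ← Finset.sum_sub_distrib, Finset.mul_sum]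
    refine Finset.sum_congr rfl fun c _ => ?_
    rw [christoffel_hyperbolicMetric hF]
    ring
  simp only [covariantHessian, h2, hyperbolicHessian, PiLp.sub_apply, PiLp.add_apply,
    PiLp.smul_apply, smul_eq_mul]
  ring

theorem partialD_prodMk {V W : Type*} [NormedAddCommGroup V] [NormedSpace ℝ V]
    [NormedAddCommGroup W] [NormedSpace ℝ W] {P : EuclideanSpace ℝ (Fin m) → V}
    {Q : EuclideanSpace ℝ (Fin m) → W} (hS : UniqueDiffOn ℝ S) (hu : u ∈ S)
    (hP : DifferentiableWithinAt ℝ P S u) (hQ : DifferentiableWithinAt ℝ Q S u) (i : Fin m) :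
    partialD S i (fun v => (P v, Q v)) u = (partialD S i P u, partialD S i Q u) :=
  partialD_eq_of_hasFDerivWithinAt (hP.hasFDerivWithinAt.prodMk hQ.hasFDerivWithinAt) hS hu i

theorem partialD_inner {P Q : EuclideanSpace ℝ (Fin m) → EuclideanSpace ℝ (Fin (m + 1))}
    (hS : UniqueDiffOn ℝ S) (hu : u ∈ S)
    (hP : DifferentiableWithinAt ℝ P S u) (hQ : DifferentiableWithinAt ℝ Q S u) (i : Fin m) :
    partialD S i (fun v => (inner ℝ (P v) (Q v) : ℝ)) u
      = inner ℝ (partialD S i P u) (Q u) + inner ℝ (P u) (partialD S i Q u) :=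
  partialD_bilin (realInner _) hS hu hP hQ i

theorem partialD_last (hS : UniqueDiffOn ℝ S) (hu : u ∈ S)
    (hF : DifferentiableWithinAt ℝ F S u) (i : Fin m) :
    partialD S i (fun v => F v (Fin.last m)) u = partialD S i F u (Fin.last m) :=
  partialD_clm (EuclideanSpace.proj (Fin.last m)) hS hu hF i

theorem differentiableWithinAt_last (hF : DifferentiableWithinAt ℝ F S u) :
    DifferentiableWithinAt ℝ (fun v => F v (Fin.last m)) S u :=
  (EuclideanSpace.proj (Fin.last m) : EuclideanSpace ℝ (Fin (m + 1)) →L[ℝ] ℝ).differentiableAt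
    |>.comp_differentiableWithinAt u hF

theorem partialD_inv {c : EuclideanSpace ℝ (Fin m) → ℝ} (hS : UniqueDiffOn ℝ S) (hu : u ∈ S)
    (hc : DifferentiableWithinAt ℝ c S u) (h0 : c u ≠ 0) (i : Fin m) :
    partialD S i (fun v => (c v)⁻¹) u = -(c u)⁻¹ ^ 2 * partialD S i c u := by
  refine (partialD_eq_of_hasFDerivWithinAt ((hasDerivAt_inv h0).comp_hasFDerivWithinAt u
    hc.hasFDerivWithinAt) hS hu i).trans ?_
  simp [partialD]

theorem partialD_hyperboloidMap (hS : UniqueDiffOn ℝ S) (hu : u ∈ S)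
    (hF : DifferentiableWithinAt ℝ F S u) (h0 : F u (Fin.last m) ≠ 0) (i : Fin m) :
    partialD S i (fun v => hyperboloidMap m (F v)) u
      = hyperboloidFirst m (F u) (partialD S i F u) := by
  have hz := differentiableWithinAt_last hF
  have hw : DifferentiableWithinAt ℝ (fun v => (F v (Fin.last m))⁻¹) S u := hz.inv h0
  have hn : DifferentiableWithinAt ℝ (fun v => (inner ℝ (F v) (F v) : ℝ)) S u := hF.inner ℝ hF
  unfold hyperboloidMap
  rw [partialD_prodMk hS hu hw ((hw.fun_smul hF).prodMk (hw.fun_mul hn)),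
    partialD_prodMk hS hu (hw.fun_smul hF) (hw.fun_mul hn), partialD_smul hS hu hw hF,
    partialD_mul hS hu hw hn, partialD_inner hS hu hF hF, partialD_inv hS hu hz h0,
    partialD_last hS hu hF, real_inner_comm (F u) (partialD S i F u)]
  simp only [hyperboloidFirst, two_mul]

theorem partialD_partialD_hyperboloidMap (hS : UniqueDiffOn ℝ S) (hu : u ∈ S)
    (hF : ∀ᶠ v in 𝓝[S] u, ContDiffWithinAt ℝ ∞ F S v)
    (h0 : ∀ᶠ v in 𝓝[S] u, F v (Fin.last m) ≠ 0) (i j : Fin m) :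
    partialD S i (partialD S j fun v => hyperboloidMap m (F v)) u
      = hyperboloidSecond m (F u) (partialD S i F u) (partialD S j F u)
          (partialD S i (partialD S j F) u) := by
  have hFu := hF.self_of_nhdsWithin hu
  have hd : DifferentiableWithinAt ℝ F S u := hFu.differentiableWithinAt (by simp)
  have hd' : DifferentiableWithinAt ℝ (partialD S j F) S u :=
    (contDiffWithinAt_partialD hS hu j hFu).differentiableWithinAt (by simp)
  have h0u := h0.self_of_nhdsWithin hu
  have hz := differentiableWithinAt_last hd
  have hz' := differentiableWithinAt_last hd'
  have hw : DifferentiableWithinAt ℝ (fun v => (F v (Fin.last m))⁻¹) S u := hz.inv h0u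
  have hw1 : DifferentiableWithinAt ℝ
      (fun v => -(F v (Fin.last m))⁻¹ ^ 2 * partialD S j F v (Fin.last m)) S u :=
    (hw.pow 2).neg.mul hz'
  have hn : DifferentiableWithinAt ℝ (fun v => (inner ℝ (F v) (F v) : ℝ)) S u := hd.inner ℝ hd
  have hn' : DifferentiableWithinAt ℝ (fun v => (inner ℝ (F v) (partialD S j F v) : ℝ)) S u :=
    hd.inner ℝ hd'
  have h2n' : DifferentiableWithinAt ℝ
      (fun v => 2 * (inner ℝ (F v) (partialD S j F v) : ℝ)) S u := hn'.const_mul 2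
  have hw1' : partialD S i (fun v => -(F v (Fin.last m))⁻¹ ^ 2 * partialD S j F v (Fin.last m)) u
      = 2 * (F u (Fin.last m))⁻¹ ^ 3 * partialD S i F u (Fin.last m)
          * partialD S j F u (Fin.last m)
        - (F u (Fin.last m))⁻¹ ^ 2 * partialD S i (partialD S j F) u (Fin.last m) := by
    -- Writing the square as a product lets the product rule and `partialD_inv` do all the work.
    have hsq : ∀ v, -(F v (Fin.last m))⁻¹ ^ 2 * partialD S j F v (Fin.last m)
        = (F v (Fin.last m))⁻¹ * ((F v (Fin.last m))⁻¹ * (-1 * partialD S j F v (Fin.last m))) :=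
      fun v => by ring
    simp only [hsq]
    have hm1 : DifferentiableWithinAt ℝ (fun v => -1 * partialD S j F v (Fin.last m)) S u :=
      hz'.const_mul (-1)
    rw [partialD_mul hS hu hw (hw.fun_mul hm1), partialD_mul hS hu hw hm1,
      partialD_mul hS hu (differentiableWithinAt_const _) hz', partialD_inv hS hu hz h0u,
      partialD_last hS hu hd, partialD_last hS hu hd']
    simp only [partialD, fderivWithin_const_apply, zero_apply]
    ring
  have h2 : partialD S i (fun v => 2 * (inner ℝ (F v) (partialD S j F v) : ℝ)) u
      = 2 * (inner ℝ (partialD S i F u) (partialD S j F u)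
          + inner ℝ (F u) (partialD S i (partialD S j F) u)) := by
    rw [partialD_mul hS hu (differentiableWithinAt_const _) hn', partialD_inner hS hu hd hd']
    simp only [partialD, fderivWithin_const_apply, zero_apply]
    ring
  have hev : (partialD S j fun v => hyperboloidMap m (F v))
      =ᶠ[𝓝[S] u] fun v => hyperboloidFirst m (F v) (partialD S j F v) := by
    filter_upwards [hF, h0, self_mem_nhdsWithin] with v hv hv0 hvS
    exact partialD_hyperboloidMap hS hvS (hv.differentiableWithinAt (by simp)) hv0 j
  rw [partialD_congr i hu hev]
  unfold hyperboloidFirst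
  dsimp only
  rw [partialD_prodMk hS hu hw1
      (((hw1.fun_smul hd).fun_add (hw.fun_smul hd')).prodMk ((hw1.fun_mul hn).fun_add (hw.fun_mul h2n'))),
    partialD_prodMk hS hu ((hw1.fun_smul hd).fun_add (hw.fun_smul hd')) ((hw1.fun_mul hn).fun_add (hw.fun_mul h2n')),
    partialD_add hS hu (hw1.fun_smul hd) (hw.fun_smul hd'),
    partialD_add hS hu (hw1.fun_mul hn) (hw.fun_mul h2n'),
    partialD_smul hS hu hw1 hd, partialD_smul hS hu hw hd', partialD_mul hS hu hw1 hn,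
    partialD_mul hS hu hw h2n', hw1', h2, partialD_inv hS hu hz h0u, partialD_last hS hu hd,
    partialD_inner hS hu hd hd, real_inner_comm (F u) (partialD S i F u), ← two_mul]
  simp only [hyperboloidSecond]

end Forms

/-! ### Curvatures of a parametrized hypersurface -/

section LocalCurvature

variable {m : ℕ} {S : Set (EuclideanSpace ℝ (Fin m))} {u : EuclideanSpace ℝ (Fin m)}
  {F : EuclideanSpace ℝ (Fin m) → EuclideanSpace ℝ (Fin (m + 1))}
  {ν ξ : EuclideanSpace ℝ (Fin (m + 1))}

/-- The matrix of the shape operator. -/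
def shapeOperator (G : MetricField (m + 1)) (S : Set (EuclideanSpace ℝ (Fin m)))
    (F : EuclideanSpace ℝ (Fin m) → EuclideanSpace ℝ (Fin (m + 1)))
    (ν : EuclideanSpace ℝ (Fin (m + 1))) (u : EuclideanSpace ℝ (Fin m)) :
    Matrix (Fin m) (Fin m) ℝ :=
  (inducedMetric G S F u)⁻¹ * secondForm G S F ν u

/-- At a single point a conformal metric is the Euclidean one after scaling every frame vector by
√c. -/
theorem scaled_inner_eq_sum_tangent_add_normal {c : ℝ} (hc : 0 < c)
    (e : Fin m → EuclideanSpace ℝ (Fin (m + 1))) (h : Matrix (Fin m) (Fin m) ℝ)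
    (hh : ∀ i j, h i j = c * inner ℝ (e i) (e j)) (hdet : h.det ≠ 0)
    (hν : c * inner ℝ ν ν = 1) (hort : ∀ i, inner ℝ (e i) ν = 0)
    (v w : EuclideanSpace ℝ (Fin (m + 1))) :
    c * inner ℝ v w = (∑ a, ∑ b, h⁻¹ a b * (c * inner ℝ v (e a)) * (c * inner ℝ w (e b)))
      + (c * inner ℝ v ν) * (c * inner ℝ w ν) := by
  have hs : √c * √c = c := Real.mul_self_sqrt hc.le
  have key := inner_eq_sum_tangent_add_normal (fun i => √c • e i) (√c • ν) h
    (fun i j => by rw [real_inner_smul_left, real_inner_smul_right, ← mul_assoc, hs, hh]) hdet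
    (by rw [real_inner_smul_left, real_inner_smul_right, ← mul_assoc, hs, hν])
    (fun i => by rw [real_inner_smul_left, real_inner_smul_right, hort, mul_zero, mul_zero]) v w
  rw [key, mul_add, Finset.mul_sum]
  simp only [real_inner_smul_right]
  congr 1
  · refine Finset.sum_congr rfl fun a _ => ?_
    rw [Finset.mul_sum]
    refine Finset.sum_congr rfl fun b _ => ?_
    linear_combination (c * h⁻¹ a b * inner ℝ v (e a) * inner ℝ w (e b)) * hs
  · linear_combination (c * inner ℝ v ν * inner ℝ w ν) * hs

theorem posSemidef_inducedMetric_euclideanMetric :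
    (inducedMetric (euclideanMetric (m + 1)) S F u).PosSemidef := by
  have h : inducedMetric (euclideanMetric (m + 1)) S F u
      = Matrix.gram ℝ fun i => partialD S i F u := by
    ext i j
    rw [inducedMetric_euclideanMetric, Matrix.gram_apply]
  rw [h]
  exact Matrix.posSemidef_gram ℝ _

theorem posSemidef_inducedMetric_hyperbolicMetric :
    (inducedMetric (hyperbolicMetric m) S F u).PosSemidef := by
  rw [inducedMetric_hyperbolicMetric_eq_smul]
  exact posSemidef_inducedMetric_euclideanMetric.smul (sq_nonneg _)

theorem secondForm_euclideanMetric (i j : Fin m) :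
    secondForm (euclideanMetric (m + 1)) S F ν u i j
      = inner ℝ (partialD S i (partialD S j F) u) ν := by
  simp [secondForm, covariantHessian_euclideanMetric, euclideanMetric_pair]

theorem secondForm_hyperbolicMetric (i j : Fin m) :
    secondForm (hyperbolicMetric m) S F ν u i j
      = (F u (Fin.last m))⁻¹ ^ 2 * inner ℝ (covariantHessian (hyperbolicMetric m) S F i j u) ν := by
  simp [secondForm, hyperbolicMetric_pair]

theorem transpose_secondForm_euclideanMetric (hS : UniqueDiffOn ℝ S) (hu : u ∈ S)
    (hcl : u ∈ closure (interior S)) (hF : ContDiffWithinAt ℝ ∞ F S u) :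
    (secondForm (euclideanMetric (m + 1)) S F ν u).transpose
      = secondForm (euclideanMetric (m + 1)) S F ν u := by
  ext i j
  rw [Matrix.transpose_apply, secondForm_euclideanMetric, secondForm_euclideanMetric,
    partialD_comm hS hu hcl hF]

/-- The hyperbolic second fundamental form in terms of the Euclidean one. -/
theorem secondForm_hyperbolicMetric_eq (hort : ∀ i, inner ℝ (partialD S i F u) ν = 0)
    (h0 : F u (Fin.last m) ≠ 0) (a : ℝ) :
    secondForm (hyperbolicMetric m) S F (a • ν) u
      = ((F u (Fin.last m))⁻¹ ^ 2 * a) • (secondForm (euclideanMetric (m + 1)) S F ν u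
          + ((F u (Fin.last m))⁻¹ * ν (Fin.last m)) •
            inducedMetric (euclideanMetric (m + 1)) S F u) := by
  ext i j
  rw [secondForm_hyperbolicMetric, covariantHessian_hyperbolicMetric h0]
  simp only [Matrix.smul_apply, Matrix.add_apply, smul_eq_mul, secondForm_euclideanMetric,
    inducedMetric_euclideanMetric, hyperbolicHessian, inner_sub_left, inner_add_left,
    real_inner_smul_left, real_inner_smul_right, hort]
  rw [real_inner_comm ν (verticalUnit m), inner_verticalUnit]
  ring

/-- The normal space is a line: in the decomposition of ξ along tangent vectors and ν, all
tangential terms vanish. -/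
theorem eq_smul_of_normal (hdet : (inducedMetric (euclideanMetric (m + 1)) S F u).det ≠ 0)
    (hν : inner ℝ ν ν = 1) (hort : ∀ i, inner ℝ (partialD S i F u) ν = 0)
    (hξ : ∀ i, inner ℝ (partialD S i F u) ξ = 0) : ξ = (inner ℝ ξ ν : ℝ) • ν := by
  refine ext_inner_right ℝ fun w => ?_
  rw [inner_eq_sum_tangent_add_normal _ ν _ inducedMetric_euclideanMetric hdet hν hort ξ w,
    real_inner_smul_left, real_inner_comm w ν]
  simp [fun i => (real_inner_comm (partialD S i F u) ξ).trans (hξ i)]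

/-- The conformal change at the heart of the theorem. The added multiple of the identity comes from
the derivative of the conformal factor along ν and does not affect the traceless part. -/
theorem shapeOperator_hyperbolicMetric
    (hdet : (inducedMetric (euclideanMetric (m + 1)) S F u).det ≠ 0)
    (hort : ∀ i, inner ℝ (partialD S i F u) ν = 0) (h0 : F u (Fin.last m) ≠ 0) (a : ℝ) :
    shapeOperator (hyperbolicMetric m) S F (a • ν) u
      = a • (shapeOperator (euclideanMetric (m + 1)) S F ν u
        + ((F u (Fin.last m))⁻¹ * ν (Fin.last m)) • 1) := by
  have h1 := Matrix.nonsing_inv_mul _ (isUnit_iff_ne_zero.2 hdet)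
  have hinv : (inducedMetric (hyperbolicMetric m) S F u)⁻¹
      = (F u (Fin.last m)) ^ 2 • (inducedMetric (euclideanMetric (m + 1)) S F u)⁻¹ := by
    apply Matrix.inv_eq_left_inv
    rw [inducedMetric_hyperbolicMetric_eq_smul, Matrix.smul_mul, Matrix.mul_smul, smul_smul, h1]
    simp [h0]
  unfold shapeOperator
  rw [hinv, secondForm_hyperbolicMetric_eq hort h0, Matrix.smul_mul, Matrix.mul_smul, smul_smul,
    Matrix.mul_add, Matrix.mul_smul, h1]
  congr 1
  field_simp

theorem transpose_secondForm_hyperbolicMetric (hS : UniqueDiffOn ℝ S) (hu : u ∈ S)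
    (hcl : u ∈ closure (interior S)) (hF : ContDiffWithinAt ℝ ∞ F S u)
    (h0 : F u (Fin.last m) ≠ 0) :
    (secondForm (hyperbolicMetric m) S F ν u).transpose
      = secondForm (hyperbolicMetric m) S F ν u := by
  ext i j
  rw [Matrix.transpose_apply, secondForm_hyperbolicMetric, secondForm_hyperbolicMetric,
    covariantHessian_hyperbolicMetric h0, covariantHessian_hyperbolicMetric h0,
    partialD_comm hS hu hcl hF]
  unfold hyperbolicHessian
  rw [real_inner_comm (partialD S i F u) (partialD S j F u), add_comm (partialD S i F u (Fin.last m) • _)]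

/-- The Gauss equation in Euclidean space. -/
theorem riemann_inducedMetric_euclideanMetric (hS : UniqueDiffOn ℝ S) (hu : u ∈ S)
    (hcl : S ⊆ closure (interior S)) (hF : ∀ᶠ v in 𝓝[S] u, ContDiffWithinAt ℝ ∞ F S v)
    (hdet : (inducedMetric (euclideanMetric (m + 1)) S F u).det ≠ 0)
    (hν : inner ℝ ν ν = 1) (hort : ∀ i, inner ℝ (partialD S i F u) ν = 0) (i j k l : Fin m) :
    riemann S (inducedMetric (euclideanMetric (m + 1)) S F) i j k l u
      = secondForm (euclideanMetric (m + 1)) S F ν u i k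
          * secondForm (euclideanMetric (m + 1)) S F ν u j l
        - secondForm (euclideanMetric (m + 1)) S F ν u j k
          * secondForm (euclideanMetric (m + 1)) S F ν u i l := by
  rw [riemann_flatMetric (β := realInner _) (Φ := F) hS hu hcl
    (fun v w => real_inner_comm w v) hF
    (Filter.Eventually.of_forall fun v i j => inducedMetric_euclideanMetric i j) hdet]
  simp only [realInner_apply, secondForm_euclideanMetric]
  -- Full pairing minus tangential part leaves the product of normal components, that is, of entries
  -- of the second fundamental form.
  have key := inner_eq_sum_tangent_add_normal _ ν _ inducedMetric_euclideanMetric hdet hν hort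
  rw [key (partialD S i (partialD S k F) u) (partialD S j (partialD S l F) u),
    key (partialD S j (partialD S k F) u) (partialD S i (partialD S l F) u)]
  ring

/-- The Gauss equation in hyperbolic space. -/
theorem riemann_inducedMetric_hyperbolicMetric (hS : UniqueDiffOn ℝ S) (hu : u ∈ S)
    (hcl : S ⊆ closure (interior S)) (hF : ∀ᶠ v in 𝓝[S] u, ContDiffWithinAt ℝ ∞ F S v)
    (h0 : F u (Fin.last m) ≠ 0) (hdet : (inducedMetric (hyperbolicMetric m) S F u).det ≠ 0)
    (hν : (F u (Fin.last m))⁻¹ ^ 2 * inner ℝ ν ν = 1)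
    (hort : ∀ i, inner ℝ (partialD S i F u) ν = 0) (i j k l : Fin m) :
    riemann S (inducedMetric (hyperbolicMetric m) S F) i j k l u
      = secondForm (hyperbolicMetric m) S F ν u i k * secondForm (hyperbolicMetric m) S F ν u j l
        - secondForm (hyperbolicMetric m) S F ν u j k * secondForm (hyperbolicMetric m) S F ν u i l
        + -1 * (inducedMetric (hyperbolicMetric m) S F u i k
            * inducedMetric (hyperbolicMetric m) S F u j l
          - inducedMetric (hyperbolicMetric m) S F u j k
            * inducedMetric (hyperbolicMetric m) S F u i l) := by
  have hFu := hF.self_of_nhdsWithin hu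
  have h0' : ∀ᶠ v in 𝓝[S] u, F v (Fin.last m) ≠ 0 :=
    (differentiableWithinAt_last
      (hFu.differentiableWithinAt (by simp))).continuousWithinAt.eventually_ne h0
  have hlift : ∀ v, F v (Fin.last m) ≠ 0 → ContDiffWithinAt ℝ ∞ F S v →
      ContDiffWithinAt ℝ ∞ (fun v => hyperboloidMap m (F v)) S v := by
    intro v hv0 hv
    have hz : ContDiffWithinAt ℝ ∞ (fun v => (F v (Fin.last m))⁻¹) S v :=
      ((EuclideanSpace.proj (Fin.last m) : EuclideanSpace ℝ (Fin (m + 1)) →L[ℝ] ℝ).contDiff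
        |>.contDiffAt.comp_contDiffWithinAt v hv).inv hv0
    exact hz.prodMk ((hz.smul hv).prodMk (hz.mul (hv.inner ℝ hv)))
  have hh : ∀ᶠ v in 𝓝[S] u, ∀ i j, inducedMetric (hyperbolicMetric m) S F v i j
      = minkowskiForm m (partialD S i (fun v => hyperboloidMap m (F v)) v)
          (partialD S j (fun v => hyperboloidMap m (F v)) v) := by
    filter_upwards [h0', hF, self_mem_nhdsWithin] with v hv0 hv hvS i j
    have hd : DifferentiableWithinAt ℝ F S v := hv.differentiableWithinAt (by simp)
    rw [partialD_hyperboloidMap hS hvS hd hv0, partialD_hyperboloidMap hS hvS hd hv0,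
      minkowskiForm_first_first hv0, inducedMetric_hyperbolicMetric]
  have hd : DifferentiableWithinAt ℝ F S u := hFu.differentiableWithinAt (by simp)
  -- The flat Gauss equation is applied to the lifted parametrization. Its image has codimension
  -- greater than one; the position vector direction supplies the term with coefficient −1.
  rw [riemann_flatMetric hS hu hcl minkowskiForm_comm
    ((h0'.and hF).mono fun v hv => hlift v hv.1 hv.2) hh hdet]
  simp only [partialD_partialD_hyperboloidMap hS hu hF h0', partialD_hyperboloidMap hS hu hd h0,
    minkowskiForm_second_first h0, minkowskiForm_second_second h0,
    secondForm_hyperbolicMetric, covariantHessian_hyperbolicMetric h0,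
    inducedMetric_hyperbolicMetric]
  have key := scaled_inner_eq_sum_tangent_add_normal (c := (F u (Fin.last m))⁻¹ ^ 2)
    (by positivity) _ _ inducedMetric_hyperbolicMetric hdet hν hort
  rw [key (hyperbolicHessian m (F u) (partialD S i F u) (partialD S k F u) _)
      (hyperbolicHessian m (F u) (partialD S j F u) (partialD S l F u) _),
    key (hyperbolicHessian m (F u) (partialD S j F u) (partialD S k F u) _)
      (hyperbolicHessian m (F u) (partialD S i F u) (partialD S l F u) _)]
  ring

end LocalCurvature

/-! ### Change of parametrization -/

section Reparam

variable {m : ℕ} {V : Type*} [NormedAddCommGroup V] [NormedSpace ℝ V]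
  {S : Set (EuclideanSpace ℝ (Fin m))} {u : EuclideanSpace ℝ (Fin m)}
  {τ : EuclideanSpace ℝ (Fin m) → EuclideanSpace ℝ (Fin m)}

theorem fderivWithin_eq_sum_partialD (F : EuclideanSpace ℝ (Fin m) → V)
    (y : EuclideanSpace ℝ (Fin m)) :
    fderivWithin ℝ F S u y = ∑ a, y a • partialD S a F u := by
  have hy : y = ∑ a, y a • EuclideanSpace.single a (1 : ℝ) := by
    ext b
    simp [Pi.single_apply]
  conv_lhs => rw [hy]
  simp [partialD]

theorem partialD_comp {F : EuclideanSpace ℝ (Fin m) → V} (hS : UniqueDiffOn ℝ S) (hu : u ∈ S)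
    (hF : DifferentiableWithinAt ℝ F S (τ u)) (hτ : DifferentiableWithinAt ℝ τ S u)
    (hτS : ∀ᶠ v in 𝓝[S] u, τ v ∈ S) (i : Fin m) :
    partialD S i (fun v => F (τ v)) u = ∑ a, partialD S i τ u a • partialD S a F (τ u) := by
  have ht : Filter.Tendsto τ (𝓝[S] u) (𝓝[S] (τ u)) :=
    tendsto_nhdsWithin_iff.2 ⟨hτ.continuousWithinAt, hτS⟩
  refine (partialD_eq_of_hasFDerivWithinAt
    (hF.hasFDerivWithinAt.comp_of_tendsto u hτ.hasFDerivWithinAt ht) hS hu i).trans ?_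
  rw [ContinuousLinearMap.comp_apply, fderivWithin_eq_sum_partialD]
  rfl

/-- The second order chain rule. -/
theorem partialD_partialD_comp {F : EuclideanSpace ℝ (Fin m) → V} (hS : UniqueDiffOn ℝ S)
    (hu : u ∈ S) (hF : ∀ᶠ v in 𝓝[S] (τ u), ContDiffWithinAt ℝ ∞ F S v)
    (hτ : ∀ᶠ v in 𝓝[S] u, ContDiffWithinAt ℝ ∞ τ S v)
    (hτS : ∀ᶠ v in 𝓝[S] u, τ v ∈ S) (i j : Fin m) :
    partialD S i (partialD S j fun v => F (τ v)) u
      = ∑ a, (partialD S i (partialD S j τ) u a • partialD S a F (τ u)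
        + partialD S j τ u a • ∑ b, partialD S i τ u b • partialD S b (partialD S a F) (τ u)) := by
  have hτu := hτ.self_of_nhdsWithin hu
  have hτd : DifferentiableWithinAt ℝ τ S u := hτu.differentiableWithinAt (by simp)
  have hτS' := hτS.self_of_nhdsWithin hu
  have hFu := hF.self_of_nhdsWithin hτS'
  have ht : Filter.Tendsto τ (𝓝[S] u) (𝓝[S] (τ u)) :=
    tendsto_nhdsWithin_iff.2 ⟨hτd.continuousWithinAt, hτS⟩
  have hev : (partialD S j fun v => F (τ v))
      =ᶠ[𝓝[S] u] fun v => ∑ a, partialD S j τ v a • partialD S a F (τ v) := by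
    filter_upwards [ht.eventually hF, hτ, eventually_eventually_nhdsWithin.2 hτS,
      self_mem_nhdsWithin] with v h1 h2 h3 h4
    exact partialD_comp hS h4 (h1.differentiableWithinAt (by simp))
      (h2.differentiableWithinAt (by simp)) h3 j
  have hd1 : DifferentiableWithinAt ℝ (partialD S j τ) S u :=
    (contDiffWithinAt_partialD hS hu j hτu).differentiableWithinAt (by simp)
  have hd1' : ∀ a, DifferentiableWithinAt ℝ (fun v => partialD S j τ v a) S u := fun a =>
    (EuclideanSpace.proj a : EuclideanSpace ℝ (Fin m) →L[ℝ] ℝ).differentiableAt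
      |>.comp_differentiableWithinAt u hd1
  have hd2 : ∀ a, DifferentiableWithinAt ℝ (partialD S a F) S (τ u) := fun a =>
    (contDiffWithinAt_partialD hS hτS' a hFu).differentiableWithinAt (by simp)
  have hd3 : ∀ a, DifferentiableWithinAt ℝ (fun v => partialD S a F (τ v)) S u := fun a =>
    ((hd2 a).hasFDerivWithinAt.comp_of_tendsto u hτd.hasFDerivWithinAt ht).differentiableWithinAt
  rw [partialD_congr i hu hev, partialD_sum Finset.univ hS hu
    (P := fun a v => partialD S j τ v a • partialD S a F (τ v))
    (fun a _ => (hd1' a).fun_smul (hd3 a))]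
  refine Finset.sum_congr rfl fun a _ => ?_
  rw [partialD_smul hS hu (hd1' a) (hd3 a), partialD_comp hS hu (hd2 a) hτd hτS]
  congr 2
  exact partialD_clm (EuclideanSpace.proj a : EuclideanSpace ℝ (Fin m) →L[ℝ] ℝ) hS hu hd1 i

variable {F F' : EuclideanSpace ℝ (Fin m) → EuclideanSpace ℝ (Fin (m + 1))}
  {ν : EuclideanSpace ℝ (Fin (m + 1))}

/-- The Jacobian matrix of a change of parametrization. -/
def jacobianMatrix (S : Set (EuclideanSpace ℝ (Fin m)))
    (τ : EuclideanSpace ℝ (Fin m) → EuclideanSpace ℝ (Fin m)) (u : EuclideanSpace ℝ (Fin m)) :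
    Matrix (Fin m) (Fin m) ℝ :=
  Matrix.of fun a i => partialD S i τ u a

theorem inducedMetric_comp (hS : UniqueDiffOn ℝ S) (hu : u ∈ S)
    (hF : DifferentiableWithinAt ℝ F S (τ u)) (hτ : DifferentiableWithinAt ℝ τ S u)
    (hτS : ∀ᶠ v in 𝓝[S] u, τ v ∈ S) (hF' : F' =ᶠ[𝓝[S] u] fun v => F (τ v)) :
    inducedMetric (euclideanMetric (m + 1)) S F' u = (jacobianMatrix S τ u).transpose
      * inducedMetric (euclideanMetric (m + 1)) S F (τ u) * jacobianMatrix S τ u := by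
  ext i j
  rw [inducedMetric_euclideanMetric, partialD_congr i hu hF', partialD_congr j hu hF',
    partialD_comp hS hu hF hτ hτS, partialD_comp hS hu hF hτ hτS, Matrix.mul_apply]
  simp only [sum_inner, inner_sum, real_inner_smul_left, real_inner_smul_right, Matrix.mul_apply,
    Matrix.transpose_apply, jacobianMatrix, Matrix.of_apply, inducedMetric_euclideanMetric,
    Finset.sum_mul]
  exact Finset.sum_congr rfl fun a _ => Finset.sum_congr rfl fun b _ => by
    rw [real_inner_comm]
    ring

/-- The second derivatives of τ multiply first derivatives of F, which are orthogonal to ν, so the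
second form transforms as a tensor. -/
theorem secondForm_comp (hS : UniqueDiffOn ℝ S) (hu : u ∈ S)
    (hF : ∀ᶠ v in 𝓝[S] (τ u), ContDiffWithinAt ℝ ∞ F S v)
    (hτ : ∀ᶠ v in 𝓝[S] u, ContDiffWithinAt ℝ ∞ τ S v)
    (hτS : ∀ᶠ v in 𝓝[S] u, τ v ∈ S) (hF' : F' =ᶠ[𝓝[S] u] fun v => F (τ v))
    (hort : ∀ a, inner ℝ (partialD S a F (τ u)) ν = 0) :
    secondForm (euclideanMetric (m + 1)) S F' ν u = (jacobianMatrix S τ u).transpose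
      * secondForm (euclideanMetric (m + 1)) S F ν (τ u) * jacobianMatrix S τ u := by
  ext i j
  have hev : partialD S j F' =ᶠ[𝓝[S] u] partialD S j fun v => F (τ v) := by
    filter_upwards [eventually_eventually_nhdsWithin.2 hF', self_mem_nhdsWithin] with v hv hvS
    exact partialD_congr j hvS hv
  rw [secondForm_euclideanMetric, partialD_congr i hu hev,
    partialD_partialD_comp hS hu hF hτ hτS, Matrix.mul_apply]
  simp only [sum_inner, inner_add_left, real_inner_smul_left, hort, mul_zero, zero_add,
    Matrix.mul_apply, Matrix.transpose_apply, jacobianMatrix, Matrix.of_apply,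
    secondForm_euclideanMetric, Finset.sum_mul, Finset.mul_sum]
  exact Finset.sum_congr rfl fun a _ => Finset.sum_congr rfl fun b _ => by ring

theorem det_jacobianMatrix_ne_zero (hS : UniqueDiffOn ℝ S) (hu : u ∈ S)
    (hF : DifferentiableWithinAt ℝ F S (τ u)) (hτ : DifferentiableWithinAt ℝ τ S u)
    (hτS : ∀ᶠ v in 𝓝[S] u, τ v ∈ S) (hF' : F' =ᶠ[𝓝[S] u] fun v => F (τ v))
    (hdet : (inducedMetric (euclideanMetric (m + 1)) S F' u).det ≠ 0) :
    (jacobianMatrix S τ u).det ≠ 0 := by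
  rw [inducedMetric_comp hS hu hF hτ hτS hF', Matrix.det_mul] at hdet
  exact right_ne_zero_of_mul hdet

theorem inner_partialD_eq_zero_of_comp (hS : UniqueDiffOn ℝ S) (hu : u ∈ S)
    (hF : DifferentiableWithinAt ℝ F S (τ u)) (hτ : DifferentiableWithinAt ℝ τ S u)
    (hτS : ∀ᶠ v in 𝓝[S] u, τ v ∈ S) (hF' : F' =ᶠ[𝓝[S] u] fun v => F (τ v))
    (hdet : (inducedMetric (euclideanMetric (m + 1)) S F' u).det ≠ 0)
    (hort : ∀ i, inner ℝ (partialD S i F' u) ν = 0) (a : Fin m) :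
    inner ℝ (partialD S a F (τ u)) ν = 0 := by
  have hJ := det_jacobianMatrix_ne_zero hS hu hF hτ hτS hF' hdet
  have h0 : Matrix.vecMul (fun a => (inner ℝ (partialD S a F (τ u)) ν : ℝ))
      (jacobianMatrix S τ u) = 0 := by
    ext i
    have := hort i
    rw [partialD_congr i hu hF', partialD_comp hS hu hF hτ hτS] at this
    simp only [sum_inner, real_inner_smul_left] at this
    refine Eq.trans ?_ this
    simp only [Matrix.vecMul, dotProduct, jacobianMatrix, Matrix.of_apply]
    exact Finset.sum_congr rfl fun b _ => mul_comm _ _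
  exact congrFun (Matrix.eq_zero_of_vecMul_eq_zero hJ h0) a

/-- The shape operators in two parametrizations are conjugate. -/
theorem shapeOperator_comp (hS : UniqueDiffOn ℝ S) (hu : u ∈ S)
    (hF : ∀ᶠ v in 𝓝[S] (τ u), ContDiffWithinAt ℝ ∞ F S v)
    (hτ : ∀ᶠ v in 𝓝[S] u, ContDiffWithinAt ℝ ∞ τ S v)
    (hτS : ∀ᶠ v in 𝓝[S] u, τ v ∈ S) (hF' : F' =ᶠ[𝓝[S] u] fun v => F (τ v))
    (hdet : (inducedMetric (euclideanMetric (m + 1)) S F' u).det ≠ 0)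
    (hort : ∀ i, inner ℝ (partialD S i F' u) ν = 0) :
    (jacobianMatrix S τ u).det ≠ 0 ∧ shapeOperator (euclideanMetric (m + 1)) S F' ν u
      = (jacobianMatrix S τ u)⁻¹ * shapeOperator (euclideanMetric (m + 1)) S F ν (τ u)
        * jacobianMatrix S τ u := by
  have hFd : DifferentiableWithinAt ℝ F S (τ u) :=
    (hF.self_of_nhdsWithin (hτS.self_of_nhdsWithin hu)).differentiableWithinAt (by simp)
  have hτd : DifferentiableWithinAt ℝ τ S u :=
    (hτ.self_of_nhdsWithin hu).differentiableWithinAt (by simp)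
  have hJ := det_jacobianMatrix_ne_zero hS hu hFd hτd hτS hF' hdet
  refine ⟨hJ, ?_⟩
  have hJt : ((jacobianMatrix S τ u).transpose)⁻¹ * (jacobianMatrix S τ u).transpose = 1 :=
    Matrix.nonsing_inv_mul _ (by rw [Matrix.det_transpose]; exact isUnit_iff_ne_zero.2 hJ)
  unfold shapeOperator
  rw [inducedMetric_comp hS hu hFd hτd hτS hF', secondForm_comp hS hu hF hτ hτS hF'
    (inner_partialD_eq_zero_of_comp hS hu hFd hτd hτS hF' hdet hort), Matrix.mul_inv_rev,
    Matrix.mul_inv_rev]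
  set J := jacobianMatrix S τ u
  simp only [Matrix.mul_assoc]
  rw [← Matrix.mul_assoc (J.transpose)⁻¹, hJt, Matrix.one_mul]

theorem trace_conj_eq {J A : Matrix (Fin m) (Fin m) ℝ} (hJ : J.det ≠ 0) :
    (J⁻¹ * A * J).trace = A.trace ∧
      ((J⁻¹ * A * J) * (J⁻¹ * A * J)).trace = (A * A).trace := by
  have h1 : J * J⁻¹ = 1 := Matrix.mul_nonsing_inv _ (isUnit_iff_ne_zero.2 hJ)
  constructor
  · rw [Matrix.trace_mul_comm, ← Matrix.mul_assoc, h1, Matrix.one_mul]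
  · have h2 : (J⁻¹ * A * J) * (J⁻¹ * A * J) = J⁻¹ * (A * A * J) := by
      calc _ = J⁻¹ * (A * ((J * J⁻¹) * (A * J))) := by simp only [Matrix.mul_assoc]
        _ = _ := by rw [h1, Matrix.one_mul]; simp only [Matrix.mul_assoc]
    rw [h2, Matrix.trace_mul_comm, Matrix.mul_assoc, h1, Matrix.mul_one]

end Reparam

/-! ### Continuity of the curvatures -/

section Continuity

variable {m : ℕ} {S : Set (EuclideanSpace ℝ (Fin m))} {u : EuclideanSpace ℝ (Fin m)}
  {F : EuclideanSpace ℝ (Fin m) → EuclideanSpace ℝ (Fin (m + 1))}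
  {ν : EuclideanSpace ℝ (Fin (m + 1))}

/-- The product of the normal components of two vectors. -/
def normalProduct (S : Set (EuclideanSpace ℝ (Fin m)))
    (F : EuclideanSpace ℝ (Fin m) → EuclideanSpace ℝ (Fin (m + 1)))
    (u : EuclideanSpace ℝ (Fin m)) (v w : EuclideanSpace ℝ (Fin (m + 1))) : ℝ :=
  inner ℝ v w - ∑ a, ∑ b, (inducedMetric (euclideanMetric (m + 1)) S F u)⁻¹ a b
    * inner ℝ v (partialD S a F u) * inner ℝ w (partialD S b F u)

/-- A product of two normal components is even in ν and can be written through the parametrization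
alone. Hence it is continuous even where ν jumps. -/
theorem normalProduct_eq (hdet : (inducedMetric (euclideanMetric (m + 1)) S F u).det ≠ 0)
    (hν : inner ℝ ν ν = 1) (hort : ∀ i, inner ℝ (partialD S i F u) ν = 0)
    (v w : EuclideanSpace ℝ (Fin (m + 1))) :
    normalProduct S F u v w = inner ℝ v ν * inner ℝ w ν := by
  rw [normalProduct, inner_eq_sum_tangent_add_normal _ ν _ inducedMetric_euclideanMetric hdet
    hν hort v w, add_sub_cancel_left]

theorem contDiffWithinAt_inducedMetric (hS : UniqueDiffOn ℝ S) (hu : u ∈ S)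
    (hF : ContDiffWithinAt ℝ ∞ F S u) (i j : Fin m) :
    ContDiffWithinAt ℝ ∞ (fun v => inducedMetric (euclideanMetric (m + 1)) S F v i j) S u := by
  simp only [inducedMetric_euclideanMetric]
  exact (contDiffWithinAt_partialD hS hu i hF).inner ℝ (contDiffWithinAt_partialD hS hu j hF)

theorem continuousWithinAt_inv_inducedMetric (hS : UniqueDiffOn ℝ S) (hu : u ∈ S)
    (hF : ContDiffWithinAt ℝ ∞ F S u)
    (hdet : (inducedMetric (euclideanMetric (m + 1)) S F u).det ≠ 0) (i j : Fin m) :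
    ContinuousWithinAt
      (fun v => (inducedMetric (euclideanMetric (m + 1)) S F v)⁻¹ i j) S u :=
  (contDiffWithinAt_inv (contDiffWithinAt_inducedMetric hS hu hF) hdet i j).continuousWithinAt

theorem continuousWithinAt_normalProduct (hS : UniqueDiffOn ℝ S) (hu : u ∈ S)
    (hF : ContDiffWithinAt ℝ ∞ F S u)
    (hdet : (inducedMetric (euclideanMetric (m + 1)) S F u).det ≠ 0)
    {P Q : EuclideanSpace ℝ (Fin m) → EuclideanSpace ℝ (Fin (m + 1))}
    (hP : ContinuousWithinAt P S u) (hQ : ContinuousWithinAt Q S u) :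
    ContinuousWithinAt (fun v => normalProduct S F v (P v) (Q v)) S u := by
  have h1 : ∀ a, ContinuousWithinAt (partialD S a F) S u := fun a =>
    (contDiffWithinAt_partialD hS hu a hF).continuousWithinAt
  unfold normalProduct
  refine (hP.inner hQ).sub ?_
  refine tendsto_finsetSum _ fun a _ => tendsto_finsetSum _ fun b _ => ?_
  exact ((continuousWithinAt_inv_inducedMetric hS hu hF hdet a b).mul (hP.inner (h1 a))).mul
    (hQ.inner (h1 b))

/-- The mean curvature vector, up to tangential terms. -/
def traceHessian (S : Set (EuclideanSpace ℝ (Fin m)))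
    (F : EuclideanSpace ℝ (Fin m) → EuclideanSpace ℝ (Fin (m + 1)))
    (u : EuclideanSpace ℝ (Fin m)) : EuclideanSpace ℝ (Fin (m + 1)) :=
  ∑ i, ∑ j, (inducedMetric (euclideanMetric (m + 1)) S F u)⁻¹ i j •
    partialD S j (partialD S i F) u

theorem continuousWithinAt_partialD_partialD (hS : UniqueDiffOn ℝ S) (hu : u ∈ S)
    (hF : ContDiffWithinAt ℝ ∞ F S u) (i j : Fin m) :
    ContinuousWithinAt (partialD S i (partialD S j F)) S u :=
  (contDiffWithinAt_partialD hS hu i (contDiffWithinAt_partialD hS hu j hF)).continuousWithinAt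

theorem continuousWithinAt_traceHessian (hS : UniqueDiffOn ℝ S) (hu : u ∈ S)
    (hF : ContDiffWithinAt ℝ ∞ F S u)
    (hdet : (inducedMetric (euclideanMetric (m + 1)) S F u).det ≠ 0) :
    ContinuousWithinAt (traceHessian S F) S u := by
  unfold traceHessian
  refine tendsto_finsetSum _ fun i _ => tendsto_finsetSum _ fun j _ => ?_
  exact (continuousWithinAt_inv_inducedMetric hS hu hF hdet i j).smul
    (continuousWithinAt_partialD_partialD hS hu hF j i)

theorem trace_shapeOperator_eq :
    (shapeOperator (euclideanMetric (m + 1)) S F ν u).trace = inner ℝ (traceHessian S F u) ν := by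
  simp [shapeOperator, traceHessian, Matrix.trace, Matrix.mul_apply, sum_inner,
    real_inner_smul_left, secondForm_euclideanMetric]

/-- The trace of the square of the shape operator, in terms of normal components only. -/
def normSqHessian (S : Set (EuclideanSpace ℝ (Fin m)))
    (F : EuclideanSpace ℝ (Fin m) → EuclideanSpace ℝ (Fin (m + 1)))
    (u : EuclideanSpace ℝ (Fin m)) : ℝ :=
  ∑ i, ∑ j, ∑ k, ∑ l, (inducedMetric (euclideanMetric (m + 1)) S F u)⁻¹ i k
    * (inducedMetric (euclideanMetric (m + 1)) S F u)⁻¹ j l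
    * normalProduct S F u (partialD S k (partialD S j F) u) (partialD S l (partialD S i F) u)

theorem continuousWithinAt_normSqHessian (hS : UniqueDiffOn ℝ S) (hu : u ∈ S)
    (hF : ContDiffWithinAt ℝ ∞ F S u)
    (hdet : (inducedMetric (euclideanMetric (m + 1)) S F u).det ≠ 0) :
    ContinuousWithinAt (normSqHessian S F) S u := by
  unfold normSqHessian
  refine tendsto_finsetSum _ fun i _ => tendsto_finsetSum _ fun j _ =>
    tendsto_finsetSum _ fun k _ => tendsto_finsetSum _ fun l _ => ?_
  exact ((continuousWithinAt_inv_inducedMetric hS hu hF hdet i k).mul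
    (continuousWithinAt_inv_inducedMetric hS hu hF hdet j l)).mul
    (continuousWithinAt_normalProduct hS hu hF hdet
      (continuousWithinAt_partialD_partialD hS hu hF k j)
      (continuousWithinAt_partialD_partialD hS hu hF l i))

/-- Each term of the trace contains two normal components, so ν can be eliminated. -/
theorem trace_shapeOperator_mul_self_eq
    (hdet : (inducedMetric (euclideanMetric (m + 1)) S F u).det ≠ 0)
    (hν : inner ℝ ν ν = 1) (hort : ∀ i, inner ℝ (partialD S i F u) ν = 0) :
    (shapeOperator (euclideanMetric (m + 1)) S F ν u
      * shapeOperator (euclideanMetric (m + 1)) S F ν u).trace = normSqHessian S F u := by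
  simp only [shapeOperator, normSqHessian, Matrix.trace, Matrix.diag, Matrix.mul_apply,
    normalProduct_eq hdet hν hort, secondForm_euclideanMetric]
  refine Finset.sum_congr rfl fun i _ => Finset.sum_congr rfl fun j _ => ?_
  rw [Finset.sum_mul_sum]
  exact Finset.sum_congr rfl fun k _ => Finset.sum_congr rfl fun l _ => by ring

end Continuity

section Manifold

variable {m : ℕ} {X : Type*} [TopologicalSpace X]
  {I : ModelWithCorners ℝ (EuclideanSpace ℝ (Fin m)) X}
  {M : Type*} [TopologicalSpace M] [ChartedSpace X M]
  {f : M → EuclideanSpace ℝ (Fin (m + 1))}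

/-! ### The chart parametrizations -/

theorem contDiffWithinAt_chartParam [IsManifold I ∞ M] (hf : IsEmbeddedHypersurface I f) (x : M)
    {u : EuclideanSpace ℝ (Fin m)} (hu : u ∈ (extChartAt I x).target) :
    ContDiffWithinAt ℝ ∞ (chartParam I f x) (Set.range I) u := by
  have h : ContMDiffOn 𝓘(ℝ, EuclideanSpace ℝ (Fin m)) 𝓘(ℝ, EuclideanSpace ℝ (Fin (m + 1))) ∞
      (f ∘ (extChartAt I x).symm) (extChartAt I x).target :=
    hf.smooth.comp_contMDiffOn (contMDiffOn_extChartAt_symm x)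
  exact (h.contDiffOn u hu).mono_of_mem_nhdsWithin (extChartAt_target_mem_nhdsWithin_of_mem hu)

theorem eventually_contDiffWithinAt_chartParam [IsManifold I ∞ M]
    (hf : IsEmbeddedHypersurface I f) (x : M)
    {u : EuclideanSpace ℝ (Fin m)} (hu : u ∈ (extChartAt I x).target) :
    ∀ᶠ v in 𝓝[Set.range I] u, ContDiffWithinAt ℝ ∞ (chartParam I f x) (Set.range I) v := by
  filter_upwards [extChartAt_target_mem_nhdsWithin_of_mem hu] with v hv
  exact contDiffWithinAt_chartParam hf x hv

theorem extChartAt_mem_range (x y : M) : extChartAt I x y ∈ Set.range I := by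
  rw [extChartAt_coe]
  exact Set.mem_range_self _

theorem partialD_chartParam [IsManifold I ∞ M] (hf : IsEmbeddedHypersurface I f) (x : M)
    (i : Fin m) :
    partialD (Set.range I) i (chartParam I f x) (extChartAt I x x)
      = mfderiv I 𝓘(ℝ, EuclideanSpace ℝ (Fin (m + 1))) f x
          (EuclideanSpace.single i (1 : ℝ) : EuclideanSpace ℝ (Fin m)) := by
  rw [((hf.smooth x).mdifferentiableAt (by simp)).mfderiv]
  rfl

/-- A Gram matrix of independent vectors: at the centre of the chart the partial derivatives are the
images of the standard basis under the injective differential of f. For other points of the chart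
domain see `eventually_chartShape`. -/
theorem det_inducedMetric_chartParam_ne_zero [IsManifold I ∞ M]
    (hf : IsEmbeddedHypersurface I f) (x : M) :
    (inducedMetric (euclideanMetric (m + 1)) (Set.range I) (chartParam I f x)
      (extChartAt I x x)).det ≠ 0 := by
  have h : inducedMetric (euclideanMetric (m + 1)) (Set.range I) (chartParam I f x)
      (extChartAt I x x) = Matrix.gram ℝ
        fun i => partialD (Set.range I) i (chartParam I f x) (extChartAt I x x) := by
    ext i j
    rw [inducedMetric_euclideanMetric, Matrix.gram_apply]
  have hli : LinearIndependent ℝ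
      fun i => partialD (Set.range I) i (chartParam I f x) (extChartAt I x x) := by
    let D : EuclideanSpace ℝ (Fin m) →L[ℝ] EuclideanSpace ℝ (Fin (m + 1)) :=
      mfderiv I 𝓘(ℝ, EuclideanSpace ℝ (Fin (m + 1))) f x
    have hD : LinearMap.ker D.toLinearMap = ⊥ := LinearMap.ker_eq_bot.2 (hf.immersive x)
    have hb : (fun i => partialD (Set.range I) i (chartParam I f x) (extChartAt I x x))
        = D.toLinearMap ∘ (EuclideanSpace.basisFun (Fin m) ℝ).toBasis := by
      funext i
      rw [partialD_chartParam hf]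
      simp [D]
      rfl
    rw [hb]
    exact (EuclideanSpace.basisFun (Fin m) ℝ).toBasis.linearIndependent.map' _ hD
  rw [h]
  exact (Matrix.posDef_gram_of_linearIndependent hli).det_pos.ne'

theorem chartParam_extChartAt (x : M) : chartParam I f x (extChartAt I x x) = f x := by
  simp [chartParam]

/-- Two chart parametrizations differ by a smooth change of coordinates. -/
theorem chartParam_transition [IsManifold I ∞ M] {x y : M} (hy : y ∈ (extChartAt I x).source) :
    let τ := fun v => extChartAt I x ((extChartAt I y).symm v)
    τ (extChartAt I y y) = extChartAt I x y ∧
    (∀ᶠ v in 𝓝[Set.range I] (extChartAt I y y), ContDiffWithinAt ℝ ∞ τ (Set.range I) v) ∧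
    (∀ᶠ v in 𝓝[Set.range I] (extChartAt I y y), τ v ∈ Set.range I) ∧
    chartParam I f y =ᶠ[𝓝[Set.range I] (extChartAt I y y)] fun v => chartParam I f x (τ v) := by
  intro τ
  have hmem : extChartAt I y y ∈ ((extChartAt I y).symm ≫ extChartAt I x).source := by
    simpa [PartialEquiv.trans_source] using hy
  have hev : ∀ᶠ v in 𝓝[Set.range I] (extChartAt I y y),
      v ∈ ((extChartAt I y).symm ≫ extChartAt I x).source :=
    I.extendCoordChange_source_mem_nhdsWithin hmem
  refine ⟨by simp [τ], hev.mono fun v hv => contDiffWithinAt_ext_coord_change x y hv,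
    Filter.Eventually.of_forall fun v => extChartAt_mem_range _ _, hev.mono fun v hv => ?_⟩
  have h2 : (extChartAt I y).symm v ∈ (extChartAt I x).source := hv.2
  simp only [chartParam, τ]
  rw [(extChartAt I x).left_inv h2]

/-- Every point is the centre of its own chart, so continuity of each local expression at that
single point is enough. -/
theorem continuous_of_chart {E : M → ℝ} {e : M → EuclideanSpace ℝ (Fin m) → ℝ}
    (he : ∀ x, ContinuousWithinAt (e x) (Set.range I) (extChartAt I x x))
    (hE : ∀ x, ∀ᶠ y in 𝓝 x, E y = e x (extChartAt I x y)) : Continuous E := by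
  refine continuous_iff_continuousAt.2 fun x => ?_
  have ht : Filter.Tendsto (extChartAt I x) (𝓝 x) (𝓝[Set.range I] extChartAt I x x) :=
    (map_extChartAt_nhds x).le
  have h1 : Filter.Tendsto E (𝓝 x) (𝓝 (e x (extChartAt I x x))) :=
    ((he x).tendsto.comp ht).congr' ((hE x).mono fun y hy => hy.symm)
  rwa [← (hE x).self_of_nhds] at h1

/-! ### Curvatures of a hypersurface -/

/-- The matrix of the Euclidean shape operator in the chart at `x`. -/
def chartShape (I : ModelWithCorners ℝ (EuclideanSpace ℝ (Fin m)) X)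
    (f ν : M → EuclideanSpace ℝ (Fin (m + 1))) (x : M) : Matrix (Fin m) (Fin m) ℝ :=
  shapeOperator (euclideanMetric (m + 1)) (Set.range I) (chartParam I f x) (ν x) (extChartAt I x x)

variable {ν ξ : M → EuclideanSpace ℝ (Fin (m + 1))}

theorem inner_self_of_isUnitNormal (hν : IsUnitNormal I (euclideanMetric (m + 1)) f ν) (x : M) :
    inner ℝ (ν x) (ν x) = 1 := by
  rw [← euclideanMetric_pair (f x)]
  exact (hν x).1

theorem inner_partialD_of_isUnitNormal [IsManifold I ∞ M] (hf : IsEmbeddedHypersurface I f)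
    (hν : IsUnitNormal I (euclideanMetric (m + 1)) f ν) (x : M) (i : Fin m) :
    inner ℝ (partialD (Set.range I) i (chartParam I f x) (extChartAt I x x)) (ν x) = 0 := by
  rw [← euclideanMetric_pair (f x), partialD_chartParam hf]
  exact (hν x).2 _

theorem inner_self_of_isUnitNormal_hyperbolic (hξ : IsUnitNormal I (hyperbolicMetric m) f ξ)
    (x : M) : (f x (Fin.last m))⁻¹ ^ 2 * inner ℝ (ξ x) (ξ x) = 1 := by
  rw [← hyperbolicMetric_pair (f x)]
  exact (hξ x).1

theorem inner_partialD_of_isUnitNormal_hyperbolic [IsManifold I ∞ M]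
    (hf : IsEmbeddedHypersurface I f) (hξ : IsUnitNormal I (hyperbolicMetric m) f ξ) (x : M)
    (h0 : f x (Fin.last m) ≠ 0) (i : Fin m) :
    inner ℝ (partialD (Set.range I) i (chartParam I f x) (extChartAt I x x)) (ξ x) = 0 := by
  have h := (hξ x).2 (EuclideanSpace.single i (1 : ℝ) : EuclideanSpace ℝ (Fin m))
  rw [← partialD_chartParam hf, hyperbolicMetric_pair] at h
  exact (mul_eq_zero.1 h).resolve_left (by positivity)

theorem meanCurvature_eq (G : MetricField (m + 1)) (x : M)
    (hh : (inducedMetric G (Set.range I) (chartParam I f x) (extChartAt I x x)).PosSemidef)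
    (hB : (secondForm G (Set.range I) (chartParam I f x) (ν x) (extChartAt I x x)).transpose
      = secondForm G (Set.range I) (chartParam I f x) (ν x) (extChartAt I x x)) :
    meanCurvature I G f ν x = 1 / (m : ℝ) *
      (shapeOperator G (Set.range I) (chartParam I f x) (ν x) (extChartAt I x x)).trace := by
  unfold meanCurvature principalCurvatures principalCurvaturesAt
  rw [sum_roots_charpoly_inv_mul hh hB]
  rfl

theorem extrinsicScalarCurvature_eq (G : MetricField (m + 1)) (x : M)
    (hh : (inducedMetric G (Set.range I) (chartParam I f x) (extChartAt I x x)).PosSemidef)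
    (hB : (secondForm G (Set.range I) (chartParam I f x) (ν x) (extChartAt I x x)).transpose
      = secondForm G (Set.range I) (chartParam I f x) (ν x) (extChartAt I x x)) :
    extrinsicScalarCurvature I G f ν x = 1 / ((m : ℝ) * ((m : ℝ) - 1)) *
      ((shapeOperator G (Set.range I) (chartParam I f x) (ν x) (extChartAt I x x)).trace ^ 2
        - (shapeOperator G (Set.range I) (chartParam I f x) (ν x) (extChartAt I x x)
          * shapeOperator G (Set.range I) (chartParam I f x) (ν x) (extChartAt I x x)).trace) := by
  unfold extrinsicScalarCurvature principalCurvatures principalCurvaturesAt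
  rw [esymm_roots_charpoly_inv_mul hh hB]
  rfl

variable [IsManifold I ∞ M]

/-- Eigenvalue sums become traces, and contracting the Gauss equation with ambient curvature 0
identifies intrinsic and extrinsic scalar curvature. -/
theorem curvatures_euclideanMetric (x : M) (hf : IsEmbeddedHypersurface I f)
    (hν : IsUnitNormal I (euclideanMetric (m + 1)) f ν) :
    meanCurvature I (euclideanMetric (m + 1)) f ν x = 1 / (m : ℝ) * (chartShape I f ν x).trace ∧
    extrinsicScalarCurvature I (euclideanMetric (m + 1)) f ν x
      = 1 / ((m : ℝ) * ((m : ℝ) - 1)) * ((chartShape I f ν x).trace ^ 2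
        - (chartShape I f ν x * chartShape I f ν x).trace) ∧
    scalarCurvature I (euclideanMetric (m + 1)) f x
      = extrinsicScalarCurvature I (euclideanMetric (m + 1)) f ν x := by
  have hu := extChartAt_mem_range (I := I) x x
  have hB : (secondForm (euclideanMetric (m + 1)) (Set.range I) (chartParam I f x) (ν x)
      (extChartAt I x x)).transpose = _ :=
    transpose_secondForm_euclideanMetric I.uniqueDiffOn hu (I.range_subset_closure_interior hu)
      (contDiffWithinAt_chartParam hf x (mem_extChartAt_target x))
  have hR := extrinsicScalarCurvature_eq (euclideanMetric (m + 1)) x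
    posSemidef_inducedMetric_euclideanMetric hB
  refine ⟨meanCurvature_eq _ x posSemidef_inducedMetric_euclideanMetric hB, hR, ?_⟩
  rw [hR]
  unfold scalarCurvature
  rw [scalarCurvatureAt_of_gauss (ε := 0) (det_inducedMetric_chartParam_ne_zero hf x) ?_ hB
    fun i j k l => ?_, zero_mul, add_zero]
  · rfl
  · ext i j
    rw [Matrix.transpose_apply, inducedMetric_euclideanMetric, inducedMetric_euclideanMetric,
      real_inner_comm]
  · rw [riemann_inducedMetric_euclideanMetric I.uniqueDiffOn hu I.range_subset_closure_interior
      (eventually_contDiffWithinAt_chartParam hf x (mem_extChartAt_target x))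
      (det_inducedMetric_chartParam_ne_zero hf x) (inner_self_of_isUnitNormal hν x)
      (inner_partialD_of_isUnitNormal hf hν x), zero_mul, add_zero]

/-- The factor is z or −z, with a sign that may depend on x in an arbitrary way; only its square is
used later. -/
theorem exists_eq_smul_normal (x : M) (hf : IsEmbeddedHypersurface I f)
    (hν : IsUnitNormal I (euclideanMetric (m + 1)) f ν)
    (hξ : IsUnitNormal I (hyperbolicMetric m) f ξ) (h0 : f x (Fin.last m) ≠ 0) :
    ∃ a : ℝ, a ^ 2 = f x (Fin.last m) ^ 2 ∧ ξ x = a • ν x := by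
  have h := eq_smul_of_normal (det_inducedMetric_chartParam_ne_zero hf x)
    (inner_self_of_isUnitNormal hν x) (inner_partialD_of_isUnitNormal hf hν x)
    (inner_partialD_of_isUnitNormal_hyperbolic hf hξ x h0)
  refine ⟨_, ?_, h⟩
  have h1 := inner_self_of_isUnitNormal_hyperbolic hξ x
  rw [h, real_inner_smul_left, real_inner_smul_right, inner_self_of_isUnitNormal hν x] at h1
  field_simp at h1
  linarith

/-- Here the ambient curvature −1 contributes −(m² − m) to the double trace; for m ≥ 2 the
normalization turns this into −1. -/
theorem curvatures_hyperbolicMetric (hm : 2 ≤ m) (x : M) (hf : IsEmbeddedHypersurface I f)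
    (hξ : IsUnitNormal I (hyperbolicMetric m) f ξ) (h0 : f x (Fin.last m) ≠ 0)
    {a : ℝ} (ha : ξ x = a • ν x)
    (hν : IsUnitNormal I (euclideanMetric (m + 1)) f ν) :
    let b := (f x (Fin.last m))⁻¹ * ν x (Fin.last m)
    let A := a • (chartShape I f ν x + b • (1 : Matrix (Fin m) (Fin m) ℝ))
    meanCurvature I (hyperbolicMetric m) f ξ x = 1 / (m : ℝ) * A.trace ∧
    extrinsicScalarCurvature I (hyperbolicMetric m) f ξ x
      = 1 / ((m : ℝ) * ((m : ℝ) - 1)) * (A.trace ^ 2 - (A * A).trace) ∧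
    scalarCurvature I (hyperbolicMetric m) f x
      = extrinsicScalarCurvature I (hyperbolicMetric m) f ξ x - 1 := by
  intro b A
  have hu := extChartAt_mem_range (I := I) x x
  have hp := chartParam_extChartAt (I := I) (f := f) x
  have h0' : chartParam I f x (extChartAt I x x) (Fin.last m) ≠ 0 := by rwa [hp]
  have hdet' := det_inducedMetric_chartParam_ne_zero hf x
  have hdet : (inducedMetric (hyperbolicMetric m) (Set.range I) (chartParam I f x)
      (extChartAt I x x)).det ≠ 0 := by
    rw [inducedMetric_hyperbolicMetric_eq_smul, Matrix.det_smul]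
    exact mul_ne_zero (by positivity) hdet'
  have hA : shapeOperator (hyperbolicMetric m) (Set.range I) (chartParam I f x) (ξ x)
      (extChartAt I x x) = A := by
    rw [ha, shapeOperator_hyperbolicMetric hdet' (inner_partialD_of_isUnitNormal hf hν x) h0' a, hp]
    rfl
  have hB : (secondForm (hyperbolicMetric m) (Set.range I) (chartParam I f x) (ξ x)
      (extChartAt I x x)).transpose = _ :=
    transpose_secondForm_hyperbolicMetric I.uniqueDiffOn hu (I.range_subset_closure_interior hu)
      (contDiffWithinAt_chartParam hf x (mem_extChartAt_target x)) h0'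
  have hR := extrinsicScalarCurvature_eq (hyperbolicMetric m) x
    posSemidef_inducedMetric_hyperbolicMetric hB
  have hH := meanCurvature_eq (hyperbolicMetric m) x posSemidef_inducedMetric_hyperbolicMetric hB
  rw [hA] at hR hH
  refine ⟨hH, hR, ?_⟩
  rw [hR]
  unfold scalarCurvature
  rw [scalarCurvatureAt_of_gauss (ε := -1) hdet ?_ hB fun i j k l => ?_]
  · change 1 / ((m : ℝ) * ((m : ℝ) - 1)) *
      ((shapeOperator (hyperbolicMetric m) (Set.range I) (chartParam I f x) (ξ x)
          (extChartAt I x x)).trace ^ 2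
        - (shapeOperator (hyperbolicMetric m) (Set.range I) (chartParam I f x) (ξ x)
            (extChartAt I x x) * shapeOperator (hyperbolicMetric m) (Set.range I)
            (chartParam I f x) (ξ x) (extChartAt I x x)).trace + -1 * ((m : ℝ) ^ 2 - m)) = _
    rw [hA]
    have hm' : (2 : ℝ) ≤ m := by exact_mod_cast hm
    have h1 : (m : ℝ) ≠ 0 := by linarith
    have h2 : (m : ℝ) - 1 ≠ 0 := by linarith
    field_simp
    ring
  · ext i j
    rw [Matrix.transpose_apply, inducedMetric_hyperbolicMetric, inducedMetric_hyperbolicMetric,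
      real_inner_comm]
  · refine riemann_inducedMetric_hyperbolicMetric I.uniqueDiffOn hu
      I.range_subset_closure_interior
      (eventually_contDiffWithinAt_chartParam hf x (mem_extChartAt_target x)) h0' hdet ?_
      (inner_partialD_of_isUnitNormal_hyperbolic hf hξ x h0) i j k l
    rw [hp]
    exact inner_self_of_isUnitNormal_hyperbolic hξ x

/-! ### Continuity on the hypersurface -/

/-- The curvatures at y are defined in the chart at y, whereas continuity at x requires one fixed
chart. The shape operators in the two charts are conjugate by the Jacobian of the transition, so
their traces agree. -/
theorem eventually_chartShape (x : M) (hf : IsEmbeddedHypersurface I f)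
    (hν : IsUnitNormal I (euclideanMetric (m + 1)) f ν) :
    ∀ᶠ y in 𝓝 x,
      (inducedMetric (euclideanMetric (m + 1)) (Set.range I) (chartParam I f x)
        (extChartAt I x y)).det ≠ 0 ∧
      (∀ i, inner ℝ (partialD (Set.range I) i (chartParam I f x) (extChartAt I x y)) (ν y) = 0) ∧
      (chartShape I f ν y).trace
        = inner ℝ (traceHessian (Set.range I) (chartParam I f x) (extChartAt I x y)) (ν y) ∧
      (chartShape I f ν y * chartShape I f ν y).trace
        = normSqHessian (Set.range I) (chartParam I f x) (extChartAt I x y) := by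
  filter_upwards [extChartAt_source_mem_nhds (I := I) x] with y hy
  obtain ⟨h1, h2, h3, h4⟩ := chartParam_transition (I := I) (f := f) hy
  set τ := fun v => extChartAt I x ((extChartAt I y).symm v) with hτ
  have hS := I.uniqueDiffOn
  have hu := extChartAt_mem_range (I := I) y y
  have hFt : extChartAt I x y ∈ (extChartAt I x).target := (extChartAt I x).map_source hy
  have hF := eventually_contDiffWithinAt_chartParam hf x hFt
  rw [← h1] at hF
  have hFd : DifferentiableWithinAt ℝ (chartParam I f x) (Set.range I) (τ (extChartAt I y y)) := by
    rw [h1]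
    exact (contDiffWithinAt_chartParam hf x hFt).differentiableWithinAt (by simp)
  have hτd : DifferentiableWithinAt ℝ τ (Set.range I) (extChartAt I y y) :=
    (h2.self_of_nhdsWithin hu).differentiableWithinAt (by simp)
  have hdet := det_inducedMetric_chartParam_ne_zero hf y
  have hort := inner_partialD_of_isUnitNormal hf hν y
  obtain ⟨hJ, hA⟩ := shapeOperator_comp hS hu hF h2 h3 h4 hdet hort
  have hdet' : (inducedMetric (euclideanMetric (m + 1)) (Set.range I) (chartParam I f x)
      (extChartAt I x y)).det ≠ 0 := by
    rw [inducedMetric_comp hS hu hFd hτd h3 h4, Matrix.det_mul, Matrix.det_mul, h1] at hdet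
    exact right_ne_zero_of_mul (left_ne_zero_of_mul hdet)
  have hort' := inner_partialD_eq_zero_of_comp hS hu hFd hτd h3 h4 hdet hort
  rw [h1] at hort' hA
  have hA' : chartShape I f ν y = _ := hA
  refine ⟨hdet', hort', ?_, ?_⟩
  · rw [hA', (trace_conj_eq hJ).1, trace_shapeOperator_eq]
  · rw [hA', (trace_conj_eq hJ).2,
      trace_shapeOperator_mul_self_eq hdet' (inner_self_of_isUnitNormal hν y) hort']

/-- Products of normal components of continuous ambient vector fields are continuous, even though
the normal need not be. -/
theorem continuous_inner_normal_mul (hf : IsEmbeddedHypersurface I f)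
    (hν : IsUnitNormal I (euclideanMetric (m + 1)) f ν) {p q : M → ℝ}
    {P Q : M → EuclideanSpace ℝ (Fin m) → EuclideanSpace ℝ (Fin (m + 1))}
    (hP : ∀ x, ContinuousWithinAt (P x) (Set.range I) (extChartAt I x x))
    (hQ : ∀ x, ContinuousWithinAt (Q x) (Set.range I) (extChartAt I x x))
    (hp : ∀ x, ∀ᶠ y in 𝓝 x, p y = inner ℝ (P x (extChartAt I x y)) (ν y))
    (hq : ∀ x, ∀ᶠ y in 𝓝 x, q y = inner ℝ (Q x (extChartAt I x y)) (ν y)) :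
    Continuous fun x => p x * q x := by
  refine continuous_of_chart (I := I)
    (e := fun x u => normalProduct (Set.range I) (chartParam I f x) u (P x u) (Q x u))
    (fun x => continuousWithinAt_normalProduct I.uniqueDiffOn (extChartAt_mem_range x x)
      (contDiffWithinAt_chartParam hf x (mem_extChartAt_target x))
      (det_inducedMetric_chartParam_ne_zero hf x) (hP x) (hQ x)) fun x => ?_
  filter_upwards [hp x, hq x, eventually_chartShape x hf hν] with y hpy hqy hy
  rw [hpy, hqy, normalProduct_eq hy.1 (inner_self_of_isUnitNormal hν y) hy.2.1]

/-- These are quantities even in ν from which, together with z, the squared mean curvatures and the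
extrinsic scalar curvatures of both metrics are built. -/
theorem continuous_chartShape (hf : IsEmbeddedHypersurface I f)
    (hν : IsUnitNormal I (euclideanMetric (m + 1)) f ν) :
    Continuous (fun x => (chartShape I f ν x).trace * (chartShape I f ν x).trace) ∧
    Continuous (fun x => (chartShape I f ν x).trace * ν x (Fin.last m)) ∧
    Continuous (fun x => ν x (Fin.last m) * ν x (Fin.last m)) ∧
    Continuous (fun x => (chartShape I f ν x * chartShape I f ν x).trace) := by
  have hT : ∀ x : M, ContinuousWithinAt (traceHessian (Set.range I) (chartParam I f x))
      (Set.range I) (extChartAt I x x) := fun x =>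
    continuousWithinAt_traceHessian I.uniqueDiffOn (extChartAt_mem_range x x)
      (contDiffWithinAt_chartParam hf x (mem_extChartAt_target x))
      (det_inducedMetric_chartParam_ne_zero hf x)
  have hT' : ∀ x : M, ∀ᶠ y in 𝓝 x, (chartShape I f ν y).trace
      = inner ℝ (traceHessian (Set.range I) (chartParam I f x) (extChartAt I x y)) (ν y) :=
    fun x => (eventually_chartShape x hf hν).mono fun y hy => hy.2.2.1
  have hV : ∀ x : M, ContinuousWithinAt (fun _ => verticalUnit m)
      (Set.range I) (extChartAt I x x) := fun x => continuousWithinAt_const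
  have hV' : ∀ x : M, ∀ᶠ y in 𝓝 x, ν y (Fin.last m) = inner ℝ (verticalUnit m) (ν y) :=
    fun x => Filter.Eventually.of_forall fun y => by
      rw [real_inner_comm, inner_verticalUnit]
  refine ⟨continuous_inner_normal_mul hf hν hT hT hT' hT',
    continuous_inner_normal_mul hf hν hT hV hT' hV',
    continuous_inner_normal_mul hf hν hV hV hV' hV', ?_⟩
  exact continuous_of_chart (I := I)
    (e := fun x => normSqHessian (Set.range I) (chartParam I f x))
    (fun x => continuousWithinAt_normSqHessian I.uniqueDiffOn (extChartAt_mem_range x x)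
      (contDiffWithinAt_chartParam hf x (mem_extChartAt_target x))
      (det_inducedMetric_chartParam_ne_zero hf x))
    fun x => (eventually_chartShape x hf hν).mono fun y hy => hy.2.2.2

end Manifold

/-! ### Volume elements -/

/-- Almost everywhere measurability of s is the natural hypothesis: an inverse chart is controlled
only on its target. -/
theorem map_withDensity_comp {α β : Type*} [MeasurableSpace α] [MeasurableSpace β]
    {μ : Measure α} {s : α → β} (hs : AEMeasurable s μ) {w : β → ENNReal} (hw : Measurable w) :
    Measure.map s (μ.withDensity fun u => w (s u)) = (Measure.map s μ).withDensity w := by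
  ext A hA
  have hs' : AEMeasurable s (μ.withDensity fun u => w (s u)) :=
    hs.mono_ac (withDensity_absolutelyContinuous _ _)
  rw [Measure.map_apply_of_aemeasurable hs' hA, withDensity_apply _ hA,
    withDensity_apply₀ _ (hs.nullMeasurableSet_preimage hA),
    Measure.restrict_map_of_aemeasurable hs hA, lintegral_map' hw.aemeasurable hs.restrict]

section Volume

variable {m : ℕ} {X : Type*} [TopologicalSpace X]
  {I : ModelWithCorners ℝ (EuclideanSpace ℝ (Fin m)) X}
  {M : Type*} [TopologicalSpace M] [ChartedSpace X M]
  {f : M → EuclideanSpace ℝ (Fin (m + 1))}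

theorem measurableSet_extChartAt_target (x : M) : MeasurableSet (extChartAt I x).target := by
  rw [extChartAt_target]
  exact (I.continuous_symm.isOpen_preimage _ (chartAt X x).open_target).measurableSet.inter
    I.isClosed_range.measurableSet

theorem continuousOn_sqrt_det [IsManifold I ∞ M] (hf : IsEmbeddedHypersurface I f) (x : M) :
    ContinuousOn (fun u => √(inducedMetric (euclideanMetric (m + 1)) (Set.range I)
      (chartParam I f x) u).det) (extChartAt I x).target := by
  intro u hu
  have h := (contDiffWithinAt_det fun i j => contDiffWithinAt_inducedMetric I.uniqueDiffOn
    (extChartAt_target_subset_range x hu) (contDiffWithinAt_chartParam hf x hu) i j)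
  exact (h.continuousWithinAt.mono (extChartAt_target_subset_range x)).sqrt

theorem aemeasurable_sqrt_det [IsManifold I ∞ M] (hf : IsEmbeddedHypersurface I f) (x : M) :
    AEMeasurable (fun u => ENNReal.ofReal (√(inducedMetric (euclideanMetric (m + 1))
      (Set.range I) (chartParam I f x) u).det)) (volume.restrict (extChartAt I x).target) :=
  ((continuousOn_sqrt_det hf x).aemeasurable (measurableSet_extChartAt_target x)).ennreal_ofReal

variable [MeasurableSpace M] [BorelSpace M]

theorem aemeasurable_extChartAt_symm (x : M) :
    AEMeasurable (extChartAt I x).symm (volume.restrict (extChartAt I x).target) :=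
  (continuousOn_extChartAt_symm x).aemeasurable (measurableSet_extChartAt_target x)

/-- Scaling an m × m metric by z^(-2) scales its determinant by z^(-2m), hence the root by z^(-m).
-/
theorem chartVolume_hyperbolicMetric [IsManifold I ∞ M] (hf : IsEmbeddedHypersurface I f)
    (hpos : ∀ x, f x ∈ upperHalfSpace m) (x : M) :
    chartVolume I (hyperbolicMetric m) f x
      = (chartVolume I (euclideanMetric (m + 1)) f x).withDensity
          fun y => ENNReal.ofReal ((f y (Fin.last m))⁻¹ ^ m) := by
  have hmeas : Measurable fun y => ENNReal.ofReal ((f y (Fin.last m))⁻¹ ^ m) := by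
    have h1 : Measurable fun y => f y (Fin.last m) :=
      ((EuclideanSpace.proj (Fin.last m) : EuclideanSpace ℝ (Fin (m + 1)) →L[ℝ] ℝ).continuous.comp
        hf.smooth.continuous).measurable
    exact (h1.inv.pow_const m).ennreal_ofReal
  have hs := aemeasurable_extChartAt_symm (I := I) x
  have hρ := aemeasurable_sqrt_det hf x
  unfold chartVolume
  rw [← map_withDensity_comp (hs.mono_ac (withDensity_absolutelyContinuous _ _)) hmeas,
    ← withDensity_mul₀ hρ (hmeas.comp_aemeasurable' hs)]
  congr 2
  funext u
  -- This holds for every u, also outside the chart target, because the total inverse chart takes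
  -- values in M. So the two densities are equal as functions.
  have hz : 0 < chartParam I f x u (Fin.last m) := hpos _
  rw [Pi.mul_apply, inducedMetric_hyperbolicMetric_eq_smul, Matrix.det_smul, Fintype.card_fin,
    ← pow_mul, mul_comm 2 m, pow_mul, Real.sqrt_mul (by positivity),
    Real.sqrt_sq (by positivity), ENNReal.ofReal_mul (by positivity), mul_comm]
  rfl

/-- The image of K in the chart is compact and the density is continuous there. -/
theorem chartVolume_lt_top [IsManifold I ∞ M] (hf : IsEmbeddedHypersurface I f) (x : M)
    {K : Set M} (hK : IsCompact K) (hKm : MeasurableSet K) (hKs : K ⊆ (chartAt X x).source) :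
    chartVolume I (euclideanMetric (m + 1)) f x K < ⊤ := by
  have hs := aemeasurable_extChartAt_symm (I := I) x
  have hKs' : K ⊆ (extChartAt I x).source := by rwa [extChartAt_source]
  have hK' : IsCompact (extChartAt I x '' K) :=
    hK.image_of_continuousOn ((continuousOn_extChartAt x).mono hKs')
  have hsub : extChartAt I x '' K ⊆ (extChartAt I x).target := by
    rintro _ ⟨y, hy, rfl⟩
    exact (extChartAt I x).map_source (hKs' hy)
  unfold chartVolume
  rw [Measure.map_apply_of_aemeasurable (hs.mono_ac (withDensity_absolutelyContinuous _ _)) hKm,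
    withDensity_apply₀ _ (hs.nullMeasurableSet_preimage hKm),
    Measure.restrict_restrict₀ (hs.nullMeasurableSet_preimage hKm)]
  refine (lintegral_mono_set ?_).trans_lt
    (((continuousOn_sqrt_det hf x).mono hsub).integrableOn_compact hK').lintegral_lt_top
  rintro u ⟨hu1, hu2⟩
  exact ⟨_, hu1, (extChartAt I x).right_inv hu2⟩

theorem measurableSet_chartCover_piece (hf : IsEmbeddedHypersurface I f) (C : ChartCover X M)
    (k : Fin C.card) : MeasurableSet (C.piece k) := by
  have : T2Space M := hf.isEmbedding.t2Space
  exact (C.isCompact_piece k).isClosed.measurableSet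

theorem measurableSet_chartCover_diff (hf : IsEmbeddedHypersurface I f) (C : ChartCover X M)
    (k : Fin C.card) :
    MeasurableSet (C.piece k \ ⋃ j : Fin C.card, ⋃ _ : j < k, C.piece j) :=
  (measurableSet_chartCover_piece hf C k).diff <| MeasurableSet.iUnion fun j =>
    MeasurableSet.iUnion fun _ => measurableSet_chartCover_piece hf C j

/-- The chosen chart cover does not depend on the metric, so both volume elements use the same
pieces and the comparison can be made chart by chart. -/
theorem volumeElement_hyperbolicMetric [CompactSpace M] [IsManifold I ∞ M] (hf : IsEmbeddedHypersurface I f)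
    (hpos : ∀ x, f x ∈ upperHalfSpace m) :
    volumeElement I (hyperbolicMetric m) f
      = (volumeElement I (euclideanMetric (m + 1)) f).withDensity
          fun y => ENNReal.ofReal ((f y (Fin.last m))⁻¹ ^ m) := by
  unfold volumeElement
  dsimp only
  rw [← Measure.sum_fintype, ← Measure.sum_fintype, withDensity_sum]
  congr 1
  funext k
  rw [chartVolume_hyperbolicMetric hf hpos,
    restrict_withDensity (measurableSet_chartCover_diff hf _ k)]

theorem isFiniteMeasure_volumeElement [CompactSpace M] [IsManifold I ∞ M] (hf : IsEmbeddedHypersurface I f) :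
    IsFiniteMeasure (volumeElement I (euclideanMetric (m + 1)) f) := by
  refine ⟨?_⟩
  unfold volumeElement
  dsimp only
  rw [Measure.finsetSum_apply]
  refine ENNReal.sum_lt_top.2 fun k _ => ?_
  rw [Measure.restrict_apply_univ]
  exact (measure_mono Set.sdiff_subset).trans_lt (chartVolume_lt_top hf _
    (ChartCover.isCompact_piece _ k) (measurableSet_chartCover_piece hf _ k)
    (ChartCover.piece_subset _ k))

end Volume

/-! ### The area formula -/

/-- Binomial expansion of `∫ (h - ρ) ^ n`. -/
theorem integral_sub_pow {M : Type*} [MeasurableSpace M] {μ : Measure M} {h ρ : M → ℝ} (n : ℕ)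
    (hint : ∀ i ∈ Finset.range (n + 1), Integrable (fun x => h x ^ (n - i) * ρ x ^ i) μ) :
    ∫ x, (h x - ρ x) ^ n ∂μ
      = ∑ i ∈ Finset.range n, (-1 : ℝ) ^ i * (n.choose i : ℝ) * ∫ x, h x ^ (n - i) * ρ x ^ i ∂μ
        + (-1) ^ n * ∫ x, ρ x ^ n ∂μ := by
  have h1 : ∀ x, (h x - ρ x) ^ n = ∑ i ∈ Finset.range (n + 1),
      (-1 : ℝ) ^ i * (n.choose i : ℝ) * (h x ^ (n - i) * ρ x ^ i) := by
    intro x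
    rw [sub_eq_neg_add, add_pow]
    refine Finset.sum_congr rfl fun i _ => ?_
    rw [neg_pow]
    ring
  simp only [h1]
  rw [integral_finsetSum _ fun i hi => (hint i hi).const_mul _, Finset.sum_range_succ]
  simp only [integral_const_mul]
  simp

/-- With l = λ this isolates the area: it is the term of index 0. -/
theorem integral_add_one_pow {M : Type*} [MeasurableSpace M] {μ : Measure M} {l : M → ℝ} (n : ℕ)
    (hint : ∀ i ∈ Finset.range (n + 1), Integrable (fun x => l x ^ i) μ) :
    ∫ x, (l x + 1) ^ n ∂μ
      = (∫ _, (1 : ℝ) ∂μ) + ∑ i ∈ Finset.Icc 1 n, (n.choose i : ℝ) * ∫ x, l x ^ i ∂μ := by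
  have h1 : ∀ x, (l x + 1) ^ n = ∑ i ∈ Finset.range (n + 1), (n.choose i : ℝ) * l x ^ i := by
    intro x
    rw [add_pow]
    exact Finset.sum_congr rfl fun i _ => by ring
  simp only [h1]
  rw [integral_finsetSum _ fun i hi => (hint i hi).const_mul _, Finset.sum_range_succ',
    Finset.range_eq_Ico, Finset.sum_Ico_add' (fun i => ∫ x, (n.choose i : ℝ) * l x ^ i ∂μ) 0 n 1]
  simp only [integral_const_mul]
  simp [add_comm, Finset.Ico_add_one_right_eq_Icc]

/-! ### Continuity of H² and R on the hypersurface, and conformal change of H² − R. -/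

section Curvatures

variable {m : ℕ} {X : Type*} [TopologicalSpace X]
  {I : ModelWithCorners ℝ (EuclideanSpace ℝ (Fin m)) X}
  {M : Type*} [TopologicalSpace M] [ChartedSpace X M] [IsManifold I ∞ M]
  {f ν ξ : M → EuclideanSpace ℝ (Fin (m + 1))}

theorem trace_smul_add_smul_one (S : Matrix (Fin m) (Fin m) ℝ) (a b : ℝ) :
    (a • (S + b • (1 : Matrix (Fin m) (Fin m) ℝ))).trace = a * (S.trace + m * b) ∧
    ((a • (S + b • (1 : Matrix (Fin m) (Fin m) ℝ))) *
      (a • (S + b • (1 : Matrix (Fin m) (Fin m) ℝ)))).trace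
      = a ^ 2 * ((S * S).trace + 2 * b * S.trace + m * b ^ 2) := by
  constructor
  · simp
    ring
  · simp [Matrix.add_mul, Matrix.mul_add]
    ring

/-- The mean curvature is squared because it changes sign with the normal. This suffices, since it
occurs only with even exponents. -/
theorem continuous_curvatures_euclideanMetric (hf : IsEmbeddedHypersurface I f)
    (hν : IsUnitNormal I (euclideanMetric (m + 1)) f ν) :
    Continuous (fun x => meanCurvature I (euclideanMetric (m + 1)) f ν x ^ 2) ∧
    Continuous (extrinsicScalarCurvature I (euclideanMetric (m + 1)) f ν) := by
  obtain ⟨h1, -, -, h4⟩ := continuous_chartShape hf hν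
  constructor
  · refine (h1.const_mul ((1 / (m : ℝ)) ^ 2)).congr fun x => ?_
    rw [(curvatures_euclideanMetric x hf hν).1]
    ring
  · refine ((h1.sub h4).const_mul (1 / ((m : ℝ) * ((m : ℝ) - 1)))).congr fun x => ?_
    rw [(curvatures_euclideanMetric x hf hν).2.1, Pi.sub_apply, ← sq]

theorem continuous_curvatures_hyperbolicMetric (hm : 2 ≤ m) (hf : IsEmbeddedHypersurface I f)
    (hpos : ∀ x, f x ∈ upperHalfSpace m)
    (hν : IsUnitNormal I (euclideanMetric (m + 1)) f ν)
    (hξ : IsUnitNormal I (hyperbolicMetric m) f ξ) :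
    Continuous (fun x => meanCurvature I (hyperbolicMetric m) f ξ x ^ 2) ∧
    Continuous (extrinsicScalarCurvature I (hyperbolicMetric m) f ξ) := by
  obtain ⟨h1, h2, h3, h4⟩ := continuous_chartShape hf hν
  have hz : Continuous fun x => f x (Fin.last m) :=
    (EuclideanSpace.proj (Fin.last m) : EuclideanSpace ℝ (Fin (m + 1)) →L[ℝ] ℝ).continuous.comp
      hf.smooth.continuous
  have hT : Continuous fun x => f x (Fin.last m) ^ 2
        * ((chartShape I f ν x).trace * (chartShape I f ν x).trace)
      + 2 * m * f x (Fin.last m) * ((chartShape I f ν x).trace * ν x (Fin.last m))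
      + m ^ 2 * (ν x (Fin.last m) * ν x (Fin.last m)) :=
    (((hz.pow 2).mul h1).add ((hz.const_mul (2 * (m : ℝ))).mul h2)).add (h3.const_mul _)
  have hQ : Continuous fun x => f x (Fin.last m) ^ 2
        * (chartShape I f ν x * chartShape I f ν x).trace
      + 2 * f x (Fin.last m) * ((chartShape I f ν x).trace * ν x (Fin.last m))
      + m * (ν x (Fin.last m) * ν x (Fin.last m)) :=
    (((hz.pow 2).mul h4).add ((hz.const_mul 2).mul h2)).add (h3.const_mul _)
  constructor
  · refine (hT.const_mul ((1 / (m : ℝ)) ^ 2)).congr fun x => ?_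
    have h0 : f x (Fin.last m) ≠ 0 := (hpos x).ne'
    obtain ⟨a, ha, hax⟩ := exists_eq_smul_normal x hf hν hξ h0
    rw [(curvatures_hyperbolicMetric hm x hf hξ h0 hax hν).1, (trace_smul_add_smul_one _ _ _).1,
      mul_pow, mul_pow, ha]
    field_simp
    ring
  · refine ((hT.sub hQ).const_mul (1 / ((m : ℝ) * ((m : ℝ) - 1)))).congr fun x => ?_
    have h0 : f x (Fin.last m) ≠ 0 := (hpos x).ne'
    obtain ⟨a, ha, hax⟩ := exists_eq_smul_normal x hf hν hξ h0
    rw [(curvatures_hyperbolicMetric hm x hf hξ h0 hax hν).2.1,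
      (trace_smul_add_smul_one _ _ _).1, (trace_smul_add_smul_one _ _ _).2, mul_pow, ha]
    congr 1
    rw [Pi.sub_apply]
    field_simp
    ring

/-- The conformal change of `H ^ 2 - R`. -/
theorem sq_meanCurvature_sub_hyperbolicMetric (hm : 2 ≤ m) (hf : IsEmbeddedHypersurface I f)
    (hpos : ∀ x, f x ∈ upperHalfSpace m)
    (hν : IsUnitNormal I (euclideanMetric (m + 1)) f ν)
    (hξ : IsUnitNormal I (hyperbolicMetric m) f ξ) (x : M) :
    meanCurvature I (hyperbolicMetric m) f ξ x ^ 2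
        - extrinsicScalarCurvature I (hyperbolicMetric m) f ξ x
      = f x (Fin.last m) ^ 2 * (meanCurvature I (euclideanMetric (m + 1)) f ν x ^ 2
        - extrinsicScalarCurvature I (euclideanMetric (m + 1)) f ν x) := by
  have h0 : f x (Fin.last m) ≠ 0 := (hpos x).ne'
  obtain ⟨a, ha, hax⟩ := exists_eq_smul_normal x hf hν hξ h0
  have hm' : (2 : ℝ) ≤ m := by exact_mod_cast hm
  have h1 : (m : ℝ) ≠ 0 := by linarith
  have h2 : (m : ℝ) - 1 ≠ 0 := by linarith
  obtain ⟨e1, e2, -⟩ := curvatures_hyperbolicMetric hm x hf hξ h0 hax hν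
  obtain ⟨e3, e4, -⟩ := curvatures_euclideanMetric x hf hν
  -- With T and Q the traces of A and A², H² − R is (mQ − T²)/(m²(m − 1)). In this combination the
  -- shift b cancels and only the factor a² survives.
  rw [e1, e2, e3, e4, (trace_smul_add_smul_one _ _ _).1, (trace_smul_add_smul_one _ _ _).2, ← ha]
  field_simp
  ring

end Curvatures

end

end HypersurfaceArea

/-! ### Assembly of the area formula. -/

theorem proposition1 {n : ℕ} (hn : 1 ≤ n)
    {X : Type*} [TopologicalSpace X]
    (I : ModelWithCorners ℝ (EuclideanSpace ℝ (Fin (2 * n))) X)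
    {M : Type*} [TopologicalSpace M] [ChartedSpace X M] [IsManifold I ∞ M] [CompactSpace M]
    [MeasurableSpace M] [BorelSpace M]
    (f : M → EuclideanSpace ℝ (Fin (2 * n + 1)))
    (hf : IsEmbeddedHypersurface I f)
    (hpos : ∀ x, f x ∈ upperHalfSpace (2 * n))
    -- `g` and `g'`: the hyperbolic and the Euclidean metric
    (g g' : MetricField (2 * n + 1))
    (hg : g = hyperbolicMetric (2 * n)) (hg' : g' = euclideanMetric (2 * n + 1))
    -- `ξ` and `ξ'`: unit normals of `M` with respect to `g` and `g'`
    (ξ ξ' : M → EuclideanSpace ℝ (Fin (2 * n + 1)))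
    (hξ : IsUnitNormal I g f ξ) (hξ' : IsUnitNormal I g' f ξ')
    -- `dA`, `H`, `R`, `lam`: volume element and curvatures of `M` with respect to `g`
    (dA : Measure M) (H R lam : M → ℝ)
    (hdA : dA = volumeElement I g f) (hH : H = meanCurvature I g f ξ)
    (hR : R = extrinsicScalarCurvature I g f ξ) (hlam : lam = scalarCurvature I g f)
    -- `dA'`, `H'`, `R'`, `lam'`: the same with respect to `g'`
    (dA' : Measure M) (H' R' lam' : M → ℝ)
    (hdA' : dA' = volumeElement I g' f) (hH' : H' = meanCurvature I g' f ξ')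
    (hR' : R' = extrinsicScalarCurvature I g' f ξ') (hlam' : lam' = scalarCurvature I g' f) :
    -- all the integrals converge
    Integrable (fun _ => (1 : ℝ)) dA ∧
    (∀ i ∈ Finset.range n, Integrable (fun x => H' x ^ (2 * (n - i)) * R' x ^ i) dA') ∧
    (∀ i ∈ Finset.range n, Integrable (fun x => H x ^ (2 * (n - i)) * R x ^ i) dA) ∧
    Integrable (fun x => lam' x ^ n) dA' ∧
    (∀ i ∈ Finset.Icc 1 n, Integrable (fun x => lam x ^ i) dA) ∧
    -- and the area formula holds
    area I g f =
      ∑ i ∈ Finset.range n, (-1 : ℝ) ^ (n + i) * (n.choose i : ℝ) *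
          ((∫ x, H' x ^ (2 * (n - i)) * R' x ^ i ∂dA')
            - ∫ x, H x ^ (2 * (n - i)) * R x ^ i ∂dA)
        + (∫ x, lam' x ^ n ∂dA')
        - ∑ i ∈ Finset.Icc 1 n, (n.choose i : ℝ) * ∫ x, lam x ^ i ∂dA := by
  subst hg hg' hdA hdA' hH hH' hR hR' hlam hlam'
  have hm : 2 ≤ 2 * n := by omega
  have hlam'eq : scalarCurvature I (euclideanMetric (2 * n + 1)) f
      = extrinsicScalarCurvature I (euclideanMetric (2 * n + 1)) f ξ' :=
    funext fun x => (curvatures_euclideanMetric x hf hξ').2.2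
  have hlameq : scalarCurvature I (hyperbolicMetric (2 * n)) f
      = fun x => extrinsicScalarCurvature I (hyperbolicMetric (2 * n)) f ξ x - 1 := by
    funext x
    obtain ⟨a, -, hax⟩ := exists_eq_smul_normal x hf hξ' hξ (hpos x).ne'
    exact (curvatures_hyperbolicMetric hm x hf hξ (hpos x).ne' hax hξ').2.2
  obtain ⟨cH', cR'⟩ := continuous_curvatures_euclideanMetric hf hξ'
  obtain ⟨cH, cR⟩ := continuous_curvatures_hyperbolicMetric hm hf hpos hξ' hξ
  have hconf := sq_meanCurvature_sub_hyperbolicMetric hm hf hpos hξ' hξ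
  have hfin := isFiniteMeasure_volumeElement hf
  have hvol := volumeElement_hyperbolicMetric hf hpos
  rw [hlam'eq, hlameq]
  unfold area
  set H := meanCurvature I (hyperbolicMetric (2 * n)) f ξ
  set R := extrinsicScalarCurvature I (hyperbolicMetric (2 * n)) f ξ
  set H' := meanCurvature I (euclideanMetric (2 * n + 1)) f ξ'
  set R' := extrinsicScalarCurvature I (euclideanMetric (2 * n + 1)) f ξ'
  set μ := volumeElement I (hyperbolicMetric (2 * n)) f
  set μ' := volumeElement I (euclideanMetric (2 * n + 1)) f
  have cz : Continuous fun x => f x (Fin.last (2 * n)) :=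
    (EuclideanSpace.proj (Fin.last (2 * n)) :
      EuclideanSpace ℝ (Fin (2 * n + 1)) →L[ℝ] ℝ).continuous.comp hf.smooth.continuous
  have cw : Continuous fun x => (f x (Fin.last (2 * n)))⁻¹ ^ (2 * n) :=
    (cz.inv₀ fun x => (hpos x).ne').pow _
  have int' : ∀ {φ : M → ℝ}, Continuous φ → Integrable φ μ' := fun hφ =>
    hφ.integrable_of_hasCompactSupport (HasCompactSupport.of_compactSpace _)
  -- The hyperbolic measure has the continuous weight z^(-2n) relative to a finite measure on
  -- compact M.
  have hfinμ : IsFiniteMeasure μ := by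
    rw [hvol]
    exact isFiniteMeasure_withDensity_ofReal (int' cw).hasFiniteIntegral
  have int : ∀ {φ : M → ℝ}, Continuous φ → Integrable φ μ := fun hφ =>
    hφ.integrable_of_hasCompactSupport (HasCompactSupport.of_compactSpace _)
  have hint' : ∀ i, Integrable (fun x => (H' x ^ 2) ^ (n - i) * R' x ^ i) μ' := fun i =>
    int' ((cH'.pow _).mul (cR'.pow _))
  have hint : ∀ i, Integrable (fun x => (H x ^ 2) ^ (n - i) * R x ^ i) μ := fun i =>
    int ((cH.pow _).mul (cR.pow _))
  have hintl : ∀ i, Integrable (fun x => (R x - 1) ^ i) μ := fun i =>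
    int ((cR.sub continuous_const).pow _)
  -- The factor z^(2n) from the n-th power of H² − R cancels the weight z^(-2n) of the volume; this
  -- is where the dimension 2n matters.
  have hinv : ∫ x, (H x ^ 2 - R x) ^ n ∂μ = ∫ x, (H' x ^ 2 - R' x) ^ n ∂μ' := by
    rw [hvol, integral_withDensity_eq_integral_toReal_smul cw.measurable.ennreal_ofReal
      (Filter.Eventually.of_forall fun x => ENNReal.ofReal_lt_top)]
    refine integral_congr_ae (Filter.Eventually.of_forall fun x => ?_)
    have hz : 0 < f x (Fin.last (2 * n)) := hpos x
    dsimp only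
    rw [ENNReal.toReal_ofReal (by positivity), hconf, smul_eq_mul, mul_pow, ← pow_mul, ← mul_assoc,
      ← mul_pow, inv_mul_cancel₀ hz.ne', one_pow, one_mul]
  rw [integral_sub_pow n fun i _ => hint i, integral_sub_pow n fun i _ => hint' i] at hinv
  -- Applied to λ = R − 1, so that the left side becomes the integral of R^n.
  have hone := integral_add_one_pow n fun i _ => hintl i
  simp only [sub_add_cancel] at hone
  simp only [pow_mul]
  refine ⟨int continuous_const, fun i _ => hint' i, fun i _ => hint i, int' (cR'.pow n),
    fun i _ => hintl i, ?_⟩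
  have hsum : ∑ i ∈ Finset.range n, (-1 : ℝ) ^ (n + i) * (n.choose i : ℝ) *
          ((∫ x, (H' x ^ 2) ^ (n - i) * R' x ^ i ∂μ') - ∫ x, (H x ^ 2) ^ (n - i) * R x ^ i ∂μ)
      = (-1) ^ n * (∑ i ∈ Finset.range n, (-1 : ℝ) ^ i * (n.choose i : ℝ) *
            ∫ x, (H' x ^ 2) ^ (n - i) * R' x ^ i ∂μ'
          - ∑ i ∈ Finset.range n, (-1 : ℝ) ^ i * (n.choose i : ℝ) *
            ∫ x, (H x ^ 2) ^ (n - i) * R x ^ i ∂μ) := by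
    rw [← Finset.sum_sub_distrib, Finset.mul_sum]
    exact Finset.sum_congr rfl fun i _ => by rw [pow_add]; ring
  have hsign : (-1 : ℝ) ^ n * (-1) ^ n = 1 := by rw [← mul_pow]; simp
  rw [hsum]
  -- Multiplying the conformal identity by (−1)^n gives the integrals of R^n coefficient 1 by
  -- `hsign`; subtracting `hone` replaces the hyperbolic one by the area and the integrals of λ^i.
  linear_combination (-1 : ℝ) ^ n * hinv - hone
    + ((∫ x, R' x ^ n ∂μ') - ∫ x, R x ^ n ∂μ) * hsign
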